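/- Let $N\ge 1$, and let $\mathcal A$ be the set of real-valued functions $u\in C_0^\infty(\mathbb R^N)$ with spherical average zero, that is, $\int_{\mathbb S^{N-1}}u(r\omega)\,dS_\omega=0$ for every $r\ge 0$ (for $N=1$, $dS$ is the counting measure on $\{-1,1\}$). Then the following hold. (i) For every $u\in\mathcal A$, the functions $|u|^2/|x|^2$ and $|\nabla u|^2$ are integrable on $\mathbb R^N$ and $$\frac{N^2}{4}\int_{\mathbb R^N}\frac{|u|^2}{|x|^2}\,dx\le\int_{\mathbb R^N}|\nabla u|^2\,dx .$$ (ii) The constant $\frac{N^2}{4}$ is optimal: for every $C>\frac{N^2}{4}$ there is $u\in\mathcal A$ with $\int_{\mathbb R^N}|\nabla u|^2\,dx< C\int_{\mathbb R^N}\frac{|u|^2}{|x|^2}\,dx$. (iii) The constant $\frac{N^2}{4}$ is not attained, neither in $\mathcal A$ nor in the completion of $\mathcal A$ with respect to the norm $\|\nabla(\cdot)\|_{L^2}$: the inequality in (i) is strict for every $u\in\mathcal A$, $u\ne 0$; and if $\varphi_k\in\mathcal A$ converge almost everywhere to a function $u$ that is not almost everywhere zero, and $\nabla\varphi_k\to G$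 in $L^2(\mathbb R^N;\mathbb R^N)$, then $|u|^2/|x|^2$ is integrable and $$\frac{N^2}{4}\int_{\mathbb R^N}\frac{|u|^2}{|x|^2}\,dx<\int_{\mathbb R^N}|G|^2\,dx .$$ -/

import Mathlib

open MeasureTheory Filter Topology
open scoped ContDiff

/-- `u` has spherical average zero: `∫_{S^{N-1}} u(r y) dS(y) = 0` for every `r ≥ 0`, where
`volume.toSphere` is the surface measure of the unit sphere of `ℝ^N`. -/
def HasSphericalAverageZero {N : ℕ} (u : EuclideanSpace ℝ (Fin N) → ℝ) : Prop :=
  ∀ r : ℝ, 0 ≤ r →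
    ∫ y : Metric.sphere (0 : EuclideanSpace ℝ (Fin N)) 1,
      u (r • (y : EuclideanSpace ℝ (Fin N)))
        ∂(volume : Measure (EuclideanSpace ℝ (Fin N))).toSphere = 0

/-- The functions in `C_0^∞(ℝ^N)` with spherical average zero. -/
structure IsAdmissible {N : ℕ} (u : EuclideanSpace ℝ (Fin N) → ℝ) : Prop where
  smooth : ContDiff ℝ ∞ u
  compactSupport : HasCompactSupport u
  averageZero : HasSphericalAverageZero u

/-- `u` belongs to the completion, with respect to the norm `‖∇ ·‖_{L²}`, of the space of
functions in `C_0^∞(ℝ^N)` with spherical average zero, and `G` is its gradient: there are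
admissible functions `φ k` with `φ k → u` almost everywhere and `∇ (φ k) → G` in `L²`. -/
def InEnergySpace {N : ℕ} (u : EuclideanSpace ℝ (Fin N) → ℝ)
    (G : EuclideanSpace ℝ (Fin N) → EuclideanSpace ℝ (Fin N)) : Prop :=
  MemLp G 2 volume ∧
    ∃ φ : ℕ → EuclideanSpace ℝ (Fin N) → ℝ,
      (∀ k, IsAdmissible (φ k)) ∧
      (∀ᵐ x, Tendsto (fun k => φ k x) atTop (𝓝 (u x))) ∧
      Tendsto (fun k => eLpNorm (fun x => gradient (φ k) x - G x) 2 volume) atTop (𝓝 0)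

/-!
The theorem rests on three facts, stated below for a finite-dimensional Euclidean space `E` of
dimension `N`.

**Sharp Poincaré inequality on the sphere** (`sphere_poincare`). If `u` has mean zero on the unit
sphere, then `(N - 1) ∫ u² ≤ ∫ |∇_τ u|²`, with `∇_τ` the tangential gradient. For `N ≥ 2` let `f` be
the extension of `u` from the sphere that is homogeneous of degree one, and let `x`, `y` be
independent Gaussian vectors. The function `φ(s) = f(x cos s + y sin s)` is `2π`-periodic, and the
law of `(x, y)` is invariant under the rotations of the pair, so that the mean of
`(f(y) - f(x))²` is the mean of `(φ(s + π/2) - φ(s))²` for every `s`, and the mean of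
`(∇f(x)·y)²` is that of `φ'(s)²`. Averaging over `s` and applying the one-dimensional inequality
`∫ (φ(s + π/2) - φ(s))² ≤ 2 ∫ φ'²` (Parseval, `integral_sub_quarter_shift_sq_le`) gives
`2 E f² ≤ 2 E |∇f|²` because `E f = 0`. In polar coordinates this is
`N ∫ u² ≤ ∫ (u² + |∇_τ u|²)` on the sphere. The Gaussian integrals in the radius are the same on
both sides and need not be evaluated. For `N = 1` the inequality is trivial.

**Hardy inequality with remainder** (`IsTestPair.hardy_remainder`). Put
`L u = x·∇u + (N - 2)/2 u`, the generator of the dilations that are unitary in `L²(dx/|x|²)`. Along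
each ray `2 u L u r^(N-3)` is the derivative of `u² r^(N-2)`, hence `∫ 2 u L u / |x|² = 0`, that is,
`∫ (x·∇u)²/|x|² = (N-2)²/4 ∫ u²/|x|² + ∫ (L u)²/|x|²`. Together with the spherical inequality and
`(N-2)²/4 + N - 1 = N²/4`, this gives `N²/4 ∫ u²/|x|² + ∫ (L u)²/|x|² ≤ ∫ |∇u|²`.

**Control of a weighted norm by the remainder** (`IsTestPair.integral_weighted_le_of_pos`).
Integrating the same derivative from `r` to infinity bounds `u² r^(N-2)` at every point of a ray by
the integral of `|2 u L u| s^(N-3)` over the ray. Hence, for every `ε > 0`,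
`∫ |x| e^(-|x|) u²/|x|² ≤ ε ∫ u²/|x|² + ε⁻¹ (∫ |∇u|² - N²/4 ∫ u²/|x|²)`. This estimate passes to the
completion. If equality held there, the last bracket would vanish, and letting `ε → 0` would give
`u = 0` almost everywhere (`hardy_strict_of_tendsto`). An admissible function belongs to the
completion, so strictness for it is a special case.

Optimality (`exists_testPair_lt`) is seen on `⟨e, x⟩ |x|^(-N/2) χ(|x|^p)` with a bump function `χ`
supported in `(0, ∞)` and `p → 0`, where `e` runs over an orthonormal basis: summing over the basis
makes all the integrals radial.
-/

/-! ### A Wirtinger inequality for the shift by a quarter period -/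

/-- Translation by a quarter period multiplies the `n`-th Fourier coefficient by `i ^ n`. -/
lemma fourierCoeffOn_add_quarter {F : ℝ → ℂ} (hper : Function.Periodic F (2 * Real.pi)) (n : ℤ) :
    fourierCoeffOn Real.two_pi_pos (fun s => F (s + Real.pi / 2)) n =
      Complex.exp (n * (Real.pi / 2) * Complex.I) * fourierCoeffOn Real.two_pi_pos F n := by
  rw [fourierCoeffOn_eq_integral, fourierCoeffOn_eq_integral]
  have hpi : (Real.pi : ℂ) ≠ 0 := by exact_mod_cast Real.pi_ne_zero
  set e : ℝ → ℂ := fun x => fourier (-n) (x : AddCircle (2 * Real.pi - 0)) with he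
  have he' : ∀ x : ℝ, e x = Complex.exp (-(n * x * Complex.I)) := by
    intro x
    simp only [he, fourier_coe_apply]
    congr 1
    push_cast
    field_simp
    ring
  have hper' : Function.Periodic (fun x => e x • F x) (2 * Real.pi) := by
    intro x
    have h1 : e (x + 2 * Real.pi) = e x := by
      have := AddCircle.coe_add_period (2 * Real.pi - 0) x
      simp only [he]
      rw [sub_zero] at *
      rw [this]
    simp only [h1, hper x]
  have h2 : ∀ x : ℝ, e x • F (x + Real.pi / 2) =
      Complex.exp (n * (Real.pi / 2) * Complex.I) *
        (e (x + Real.pi / 2) • F (x + Real.pi / 2)) := by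
    intro x
    rw [he', he', smul_eq_mul, smul_eq_mul, ← mul_assoc, ← Complex.exp_add]
    congr 2
    push_cast
    ring
  have h3 : (∫ x in (0:ℝ)..(2 * Real.pi), e x • F (x + Real.pi / 2)) =
      Complex.exp (n * (Real.pi / 2) * Complex.I) *
        ∫ x in (0:ℝ)..(2 * Real.pi), e x • F x := by
    simp_rw [h2]
    rw [intervalIntegral.integral_const_mul,
      intervalIntegral.integral_comp_add_right (fun x => e x • F x)]
    congr 1
    have := hper'.intervalIntegral_add_eq (Real.pi / 2) 0
    rw [zero_add] at *
    rw [← this]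
    congr 1
    ring
  rw [h3]
  simp only [Complex.real_smul]
  ring

/-- The multiplier of `φ ↦ φ (· + π / 2) - φ` is at most `√2` times that of the derivative. -/
lemma norm_exp_quarter_sub_one_sq_le (n : ℤ) :
    ‖Complex.exp (n * (Real.pi / 2) * Complex.I) - 1‖ ^ 2 ≤ 2 * (n : ℝ) ^ 2 := by
  have key : ‖Complex.exp (n * (Real.pi / 2) * Complex.I) - 1‖ ≤ 2 := by
    refine (norm_sub_le _ _).trans ?_
    have : ‖Complex.exp (n * (Real.pi / 2) * Complex.I)‖ = 1 := by
      have := Complex.norm_exp_ofReal_mul_I (n * (Real.pi / 2))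
      push_cast at this
      exact this
    rw [this]; norm_num
  rcases lt_trichotomy n 0 with h | h | h
  · rcases eq_or_lt_of_le (Int.le_sub_one_of_lt h) with h1 | h1
    · subst h1
      have : Complex.exp (((0 - 1 : ℤ) : ℂ) * (Real.pi / 2) * Complex.I) = -Complex.I := by
        have h2 : ((0 - 1 : ℤ) : ℂ) * (Real.pi / 2) * Complex.I = -(Real.pi / 2 * Complex.I) := by
          push_cast; ring
        rw [h2, Complex.exp_neg, Complex.exp_pi_div_two_mul_I, Complex.inv_I]
      rw [this, ← Complex.normSq_eq_norm_sq, Complex.normSq_apply]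
      norm_num
    · have h2 : (n : ℝ) ≤ -2 := by exact_mod_cast (by omega : n ≤ -2)
      nlinarith [norm_nonneg (Complex.exp (n * (Real.pi / 2) * Complex.I) - 1)]
  · subst h; simp
  · rcases eq_or_lt_of_le (Int.add_one_le_of_lt h) with h1 | h1
    · subst h1
      have : Complex.exp (((0 + 1 : ℤ) : ℂ) * (Real.pi / 2) * Complex.I) = Complex.I := by
        have h2 : ((0 + 1 : ℤ) : ℂ) * (Real.pi / 2) * Complex.I = (Real.pi / 2 * Complex.I) := by
          push_cast; ring
        rw [h2, Complex.exp_pi_div_two_mul_I]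
      rw [this, ← Complex.normSq_eq_norm_sq, Complex.normSq_apply]
      norm_num
    · have h2 : (2 : ℝ) ≤ n := by exact_mod_cast (by omega : 2 ≤ n)
      nlinarith [norm_nonneg (Complex.exp (n * (Real.pi / 2) * Complex.I) - 1)]

/-- A Wirtinger-type inequality. In Fourier coefficients it reads `|i ^ n - 1|² ≤ 2 n²`, with
equality for `n = 0, ±1`; this is why it leads to sharp Poincaré inequalities. -/
lemma integral_sub_quarter_shift_sq_le {φ φ' : ℝ → ℝ} (hper : Function.Periodic φ (2 * Real.pi))
    (hd : ∀ s, HasDerivAt φ (φ' s) s) (hc : Continuous φ') :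
    ∫ s in (0:ℝ)..(2 * Real.pi), (φ (s + Real.pi / 2) - φ s) ^ 2 ≤
      2 * ∫ s in (0:ℝ)..(2 * Real.pi), φ' s ^ 2 := by
  have hφ : Continuous φ := continuous_iff_continuousAt.2 fun s => (hd s).continuousAt
  set F : ℝ → ℂ := fun s => (φ s : ℂ) with hF
  have hFc : Continuous F := by fun_prop
  have hFper : Function.Periodic F (2 * Real.pi) := fun s => by simp [hF, hper s]
  have memL : ∀ f : ℝ → ℂ, Continuous f →
      MemLp f 2 (volume.restrict (Set.Ioc 0 (2 * Real.pi))) := by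
    intro f hf
    obtain ⟨B, hB⟩ := isCompact_Icc.exists_bound_of_continuousOn
      (hf.continuousOn (s := Set.Icc 0 (2 * Real.pi)))
    refine MemLp.of_bound hf.aestronglyMeasurable B ?_
    filter_upwards [ae_restrict_mem measurableSet_Ioc] with x hx
    exact hB x (Set.Ioc_subset_Icc_self hx)
  have hs1 := hasSum_sq_fourierCoeffOn Real.two_pi_pos
    (memL (fun s => F (s + Real.pi / 2) - F s) (by fun_prop))
  have hs2 := (hasSum_sq_fourierCoeffOn Real.two_pi_pos
    (memL (fun s => (φ' s : ℂ)) (by fun_prop))).mul_left 2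
  have hle := hasSum_le (fun n => ?_) hs1 hs2
  · simp only [sub_zero, smul_eq_mul, hF, ← Complex.ofReal_sub, Complex.norm_real,
      Real.norm_eq_abs, sq_abs] at hle
    have h2 := mul_le_mul_of_nonneg_left hle Real.two_pi_pos.le
    rw [← mul_assoc, mul_inv_cancel₀ Real.two_pi_pos.ne', one_mul] at h2
    refine h2.trans (le_of_eq ?_)
    have := Real.pi_ne_zero
    field_simp
  · have h1 : fourierCoeffOn Real.two_pi_pos (fun s => F (s + Real.pi / 2) - F s) n =
        (Complex.exp (n * (Real.pi / 2) * Complex.I) - 1) *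
          fourierCoeffOn Real.two_pi_pos F n := by
      rw [sub_mul, one_mul, ← fourierCoeffOn_add_quarter hFper, fourierCoeffOn_eq_integral,
        fourierCoeffOn_eq_integral, fourierCoeffOn_eq_integral, ← smul_sub,
        ← intervalIntegral.integral_sub]
      · simp only [smul_sub]
      · apply Continuous.intervalIntegrable
        exact ((map_continuous (fourier (-n))).comp (AddCircle.continuous_mk' _)).smul
          (by fun_prop)
      · apply Continuous.intervalIntegrable
        exact ((map_continuous (fourier (-n))).comp (AddCircle.continuous_mk' _)).smul hFc
    rw [h1, norm_mul, mul_pow]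
    rcases eq_or_ne n 0 with rfl | hn
    · simp
    have h3 := fourierCoeffOn_of_hasDerivAt Real.two_pi_pos hn (f := F)
      (f' := fun s => (φ' s : ℂ)) (fun x _ => (hd x).ofReal_comp)
      (Continuous.intervalIntegrable (by fun_prop) _ _)
    have h4 : F (2 * Real.pi) - F 0 = 0 := by
      have := hFper 0
      rw [zero_add] at this
      rw [this, sub_self]
    have hpi : (Real.pi : ℂ) ≠ 0 := by exact_mod_cast Real.pi_ne_zero
    have hn' : (n : ℂ) ≠ 0 := by exact_mod_cast hn
    have h5 : fourierCoeffOn Real.two_pi_pos (fun s => (φ' s : ℂ)) n =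
        Complex.I * n * fourierCoeffOn Real.two_pi_pos F n := by
      rw [h3, h4]
      push_cast
      field_simp
      ring_nf
    rw [h5, norm_mul, norm_mul, Complex.norm_I, one_mul, mul_pow, ← mul_assoc,
      Complex.norm_intCast, sq_abs]
    exact mul_le_mul_of_nonneg_right (norm_exp_quarter_sub_one_sq_le n) (sq_nonneg _)

/-! ### Polar coordinates, rotations of pairs, and isotropy -/

/-- The measure `r ^ n dr` on the half-line `(0, ∞)`, as a measure on `ℝ`. -/
noncomputable def radialMeasure (n : ℕ) : Measure ℝ :=
  (volume.restrict (Set.Ioi 0)).withDensity fun r => ENNReal.ofReal (r ^ n)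

instance (n : ℕ) : SigmaFinite (radialMeasure n) := by
  unfold radialMeasure; infer_instance

lemma ae_radialMeasure_pos (n : ℕ) : ∀ᵐ r ∂radialMeasure n, 0 < r :=
  (withDensity_absolutelyContinuous _ _).ae_le (ae_restrict_mem measurableSet_Ioi)

lemma integral_radialMeasure (n : ℕ) (f : ℝ → ℝ) :
    ∫ r, f r ∂radialMeasure n = ∫ r in Set.Ioi 0, r ^ n * f r := by
  rw [radialMeasure, integral_withDensity_eq_integral_toReal_smul (by fun_prop)
    (by simp)]
  refine setIntegral_congr_fun measurableSet_Ioi fun r (hr : 0 < r) => ?_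
  simp [ENNReal.toReal_ofReal (pow_nonneg hr.le _)]

section polar
variable {E : Type*} [NormedAddCommGroup E] [InnerProductSpace ℝ E] [FiniteDimensional ℝ E]
  [MeasurableSpace E] [BorelSpace E]

local notation "dim" => Module.finrank ℝ

lemma integrable_sphere_of_continuous {k : Metric.sphere (0 : E) 1 → ℝ} (hk : Continuous k) :
    Integrable k (volume : Measure E).toSphere :=
  hk.integrable_of_hasCompactSupport (HasCompactSupport.of_compactSpace _)

variable (E) [Nontrivial E]

/-- Polar coordinates as a map defined on all of `sphere × ℝ`, so that integrals over `E` can be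
written as iterated integrals without subtypes of the half-line. -/
lemma measurePreserving_polar :
    MeasurePreserving (fun p : Metric.sphere (0 : E) 1 × ℝ => p.2 • (p.1 : E))
      ((volume : Measure E).toSphere.prod (radialMeasure (dim E - 1))) volume := by
  have h1 : MeasurePreserving (Subtype.val : Set.Ioi (0:ℝ) → ℝ)
      (Measure.volumeIoiPow (Module.finrank ℝ E - 1)) (radialMeasure (dim E - 1)) := by
    refine ⟨measurable_subtype_coe, ?_⟩
    have h := (MeasurableEmbedding.subtype_coe (measurableSet_Ioi (a := (0:ℝ))))
    ext s hs
    rw [Measure.map_apply measurable_subtype_coe hs, Measure.volumeIoiPow,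
      withDensity_apply _ (measurable_subtype_coe hs), radialMeasure, withDensity_apply _ hs,
      ← map_comap_subtype_coe measurableSet_Ioi, h.restrict_map, h.lintegral_map]
  have h2 := (MeasurePreserving.id (volume : Measure E).toSphere).prod h1
  have h3 := (Measure.measurePreserving_homeomorphUnitSphereProd (volume : Measure E)).symm
    (homeomorphUnitSphereProd E).toMeasurableEquiv
  have h4 : MeasurePreserving (Subtype.val : ({0}ᶜ : Set E) → E)
      ((volume : Measure E).comap (↑)) volume := by
    refine ⟨measurable_subtype_coe, ?_⟩
    rw [map_comap_subtype_coe (measurableSet_singleton _).compl, restrict_compl_singleton]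
  have h5 := h4.comp h3
  refine ⟨by fun_prop, ?_⟩
  rw [← h2.map_eq, Measure.map_map (by fun_prop) h2.measurable]
  exact h5.map_eq

variable {E}

lemma integral_eq_integral_sphere_radial {f : E → ℝ} (hf : Integrable f) :
    ∫ x, f x = ∫ y : Metric.sphere (0 : E) 1, ∫ r, f (r • (y : E)) ∂radialMeasure (dim E - 1)
      ∂(volume : Measure E).toSphere := by
  have h := measurePreserving_polar E
  have h' := integral_map h.measurable.aemeasurable
    (by rw [h.map_eq]; exact hf.aestronglyMeasurable)
  rw [h.map_eq] at h'
  rw [h']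
  exact integral_prod _ ((h.integrable_comp hf.aestronglyMeasurable).2 hf)

lemma integral_eq_integral_radial_sphere {f : E → ℝ} (hf : Integrable f) :
    ∫ x, f x = ∫ r, ∫ y : Metric.sphere (0 : E) 1, f (r • (y : E))
      ∂(volume : Measure E).toSphere ∂radialMeasure (dim E - 1) := by
  have h := measurePreserving_polar E
  have h' := integral_map h.measurable.aemeasurable
    (by rw [h.map_eq]; exact hf.aestronglyMeasurable)
  rw [h.map_eq] at h'
  rw [h']
  exact integral_prod_symm _ ((h.integrable_comp hf.aestronglyMeasurable).2 hf)

end polar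

section rotation
variable (E : Type*) [NormedAddCommGroup E] [InnerProductSpace ℝ E] [FiniteDimensional ℝ E]
  [MeasurableSpace E] [BorelSpace E]

/-- The rotation of pairs of vectors by the angle `s` preserves the volume. The second component is
the first one at the angle `s + π / 2`. -/
lemma measurePreserving_rotate (s : ℝ) :
    MeasurePreserving (fun p : E × E => (Real.cos s • p.1 + Real.sin s • p.2,
      Real.cos (s + Real.pi / 2) • p.1 + Real.sin (s + Real.pi / 2) • p.2)) volume volume := by
  have hcs := Real.sin_sq_add_cos_sq s
  let T : WithLp 2 (E × E) →ₗ[ℝ] WithLp 2 (E × E) :=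
    { toFun := fun p => WithLp.toLp 2 (Real.cos s • p.fst + Real.sin s • p.snd,
        -Real.sin s • p.fst + Real.cos s • p.snd)
      map_add' := by
        intro p q
        apply WithLp.ofLp_injective
        ext <;> simp <;> module
      map_smul' := by
        intro c p
        apply WithLp.ofLp_injective
        ext <;> simp <;> module }
  have hT : ∀ p, ‖T p‖ = ‖p‖ := by
    intro p
    rw [← sq_eq_sq₀ (norm_nonneg _) (norm_nonneg _), WithLp.prod_norm_sq_eq_of_L2,
      WithLp.prod_norm_sq_eq_of_L2]
    simp only [T, LinearMap.coe_mk, AddHom.coe_mk, WithLp.toLp_fst, WithLp.toLp_snd]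
    rw [norm_add_sq_real, norm_add_sq_real]
    simp only [norm_smul, inner_smul_left, inner_smul_right, norm_neg, mul_pow, Real.norm_eq_abs,
      sq_abs, conj_trivial]
    linear_combination (‖p.fst‖ ^ 2 + ‖p.snd‖ ^ 2) * hcs
  let L : WithLp 2 (E × E) →ₗᵢ[ℝ] WithLp 2 (E × E) := ⟨T, hT⟩
  have h := (WithLp.volume_preserving_ofLp E E).comp
    ((L.toLinearIsometryEquiv rfl).measurePreserving.comp (WithLp.volume_preserving_toLp E E))
  have h' : (fun p : E × E => (Real.cos s • p.1 + Real.sin s • p.2,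
      Real.cos (s + Real.pi / 2) • p.1 + Real.sin (s + Real.pi / 2) • p.2)) =
      WithLp.ofLp ∘ (L.toLinearIsometryEquiv rfl) ∘ WithLp.toLp 2 := by
    ext p <;> simp [L, T, Real.cos_add_pi_div_two, Real.sin_add_pi_div_two]
  rw [h']
  exact h

variable {E}

/-- Isotropy of the second moments of a radial density: `∫ ⟨a, y⟩² w(|y|) dy` depends on `a` only
through its norm, since a reflection exchanges any two vectors of equal norm, and summing over an
orthonormal basis determines the constant. -/
lemma finrank_mul_integral_inner_sq_mul_eq (w : ℝ → ℝ)
    (hw : Integrable fun y : E => ‖y‖ ^ 2 * w ‖y‖) (hw' : Measurable w) (a : E) :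
    Module.finrank ℝ E * ∫ y : E, inner ℝ a y ^ 2 * w ‖y‖ = ‖a‖ ^ 2 * ∫ y : E, ‖y‖ ^ 2 * w ‖y‖ := by
  have hint : ∀ b : E, Integrable fun y : E => inner ℝ b y ^ 2 * w ‖y‖ := by
    intro b
    refine (hw.norm.const_mul (‖b‖ ^ 2)).mono' (by fun_prop) (ae_of_all _ fun y => ?_)
    rw [norm_mul, norm_mul, ← mul_assoc, norm_pow, norm_pow, norm_norm, ← mul_pow]
    gcongr
    exact norm_inner_le_norm b y
  have hrefl : ∀ b : E, ‖b‖ = ‖a‖ →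
      ∫ y : E, inner ℝ b y ^ 2 * w ‖y‖ = ∫ y : E, inner ℝ a y ^ 2 * w ‖y‖ := by
    intro b hb
    set R := (Submodule.span ℝ {b - a})ᗮ.reflection with hR
    have h1 : R b = a := Submodule.reflection_sub hb
    refine Eq.trans ?_ (R.measurePreserving.integral_comp R.toHomeomorph.measurableEmbedding _)
    refine integral_congr_ae (ae_of_all _ fun y => ?_)
    simp only [LinearIsometryEquiv.norm_map]
    rw [← h1, LinearIsometryEquiv.inner_map_map]
  set b := stdOrthonormalBasis ℝ E
  have hsum : ∀ y : E, ‖y‖ ^ 2 * w ‖y‖ = ∑ i, inner ℝ (b i) y ^ 2 * w ‖y‖ := by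
    intro y
    rw [← Finset.sum_mul, ← b.sum_sq_norm_inner_right y]
    simp
  have : ∀ i, ‖a‖ ^ 2 * ∫ y : E, inner ℝ (b i) y ^ 2 * w ‖y‖ =
      ∫ y : E, inner ℝ a y ^ 2 * w ‖y‖ := by
    intro i
    rw [← hrefl (‖a‖ • b i) (by simp [norm_smul]), ← integral_const_mul]
    refine integral_congr_ae (ae_of_all _ fun y => ?_)
    simp only [inner_smul_left, conj_trivial]
    ring
  simp_rw [hsum]
  rw [integral_finsetSum _ fun i _ => hint _, Finset.mul_sum]
  simp [this]

end rotation

/-! ### Homogeneous extensions along great circles -/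

section homExt
variable {E : Type*} [NormedAddCommGroup E] [InnerProductSpace ℝ E]

/-- The extension, homogeneous of degree one, of the restriction of `u` to the unit sphere. -/
noncomputable def homExt (u : E → ℝ) (x : E) : ℝ := ‖x‖ * u (‖x‖⁻¹ • x)

/-- The gradient of `homExt u` away from the origin, if `g` is the gradient of `u`. -/
noncomputable def homExtGrad (u : E → ℝ) (g : E → E) (x : E) : E :=
  u (‖x‖⁻¹ • x) • (‖x‖⁻¹ • x) +
    (g (‖x‖⁻¹ • x) - inner ℝ (g (‖x‖⁻¹ • x)) (‖x‖⁻¹ • x) • (‖x‖⁻¹ • x))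

lemma norm_inv_smul_smul_sphere {r : ℝ} (hr : 0 < r) (y : Metric.sphere (0 : E) 1) :
    ‖r • (y : E)‖⁻¹ • (r • (y : E)) = y := by
  have hy : ‖(y : E)‖ = 1 := by simp
  rw [norm_smul, hy, mul_one, Real.norm_of_nonneg hr.le, smul_smul, inv_mul_cancel₀ hr.ne',
    one_smul]

lemma norm_smul_sphere {r : ℝ} (hr : 0 < r) (y : Metric.sphere (0 : E) 1) :
    ‖r • (y : E)‖ = r := by
  have hy : ‖(y : E)‖ = 1 := by simp
  rw [norm_smul, hy, mul_one, Real.norm_of_nonneg hr.le]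

/-- On the unit sphere, the squared norm of the gradient of the homogeneous extension is the sum of
the squares of the function and of its tangential gradient. -/
lemma norm_homExtGrad_sq_of_norm_eq_one {u : E → ℝ} {g : E → E} {ξ : E} (h : ‖ξ‖ = 1) :
    ‖u ξ • ξ + (g ξ - inner ℝ (g ξ) ξ • ξ)‖ ^ 2 = u ξ ^ 2 + (‖g ξ‖ ^ 2 - inner ℝ (g ξ) ξ ^ 2) := by
  simp only [← real_inner_self_eq_norm_sq, inner_add_left, inner_add_right, inner_sub_left,
    inner_sub_right, inner_smul_left, inner_smul_right, conj_trivial, real_inner_comm ξ (g ξ)]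
  have h1 : inner ℝ ξ ξ = (1 : ℝ) := by rw [real_inner_self_eq_norm_sq, h, one_pow]
  rw [h1]
  ring

lemma hasDerivAt_homExt_comp {u : E → ℝ} {g : E → E} [CompleteSpace E]
    (hu : ∀ x, HasGradientAt u (g x) x)
    {c : ℝ → E} {c' : E} {s : ℝ} (hc : HasDerivAt c c' s) (h0 : c s ≠ 0) :
    HasDerivAt (fun t => homExt u (c t)) (inner ℝ (homExtGrad u g (c s)) c') s := by
  have hn0 : ‖c s‖ ≠ 0 := norm_ne_zero_iff.2 h0
  have hn : HasDerivAt (fun t => ‖c t‖) (inner ℝ (c s) c' / ‖c s‖) s := by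
    have h1 : HasDerivAt (fun t => √(‖c t‖ ^ 2)) _ s := hc.norm_sq.sqrt (by positivity)
    simp only [Real.sqrt_sq (norm_nonneg _)] at h1
    convert h1 using 1
    field_simp
  have hξ := (hn.inv hn0).smul hc
  have h1 := hn.mul ((hu (‖c s‖⁻¹ • c s)).hasFDerivAt.comp_hasDerivAt s hξ)
  refine h1.congr_deriv ?_
  simp only [InnerProductSpace.toDual_apply_apply, homExtGrad, Function.comp_apply, Pi.inv_apply,
    Pi.smul_apply',
    inner_add_left, inner_sub_left,
    inner_smul_left, inner_add_right, inner_smul_right, conj_trivial]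
  field_simp
  ring

lemma measurable_homExt [MeasurableSpace E] [BorelSpace E] [SecondCountableTopology E] {u : E → ℝ}
    (hu : Continuous u) : Measurable (homExt u) := by
  unfold homExt
  have := hu.measurable
  fun_prop

lemma measurable_homExtGrad [MeasurableSpace E] [BorelSpace E] [SecondCountableTopology E]
    {u : E → ℝ} {g : E → E}
    (hu : Continuous u) (hg : Continuous g) : Measurable (homExtGrad u g) := by
  unfold homExtGrad
  have := hu.measurable
  have := hg.measurable
  fun_prop

lemma exists_abs_homExt_le [FiniteDimensional ℝ E] {u : E → ℝ} (hu : Continuous u) :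
    ∃ B, 0 ≤ B ∧ ∀ x, |homExt u x| ≤ B * ‖x‖ := by
  obtain ⟨B, hB⟩ := (isCompact_closedBall (0 : E) 1).exists_bound_of_continuousOn hu.continuousOn
  refine ⟨B, (norm_nonneg _).trans (hB 0 (by simp)), fun x => ?_⟩
  rw [homExt, abs_mul, abs_norm, mul_comm]
  gcongr
  refine hB _ ?_
  simp only [mem_closedBall_zero_iff, norm_smul, norm_inv, norm_norm]
  exact inv_mul_le_one

lemma exists_norm_homExtGrad_le [FiniteDimensional ℝ E] {u : E → ℝ} {g : E → E}
    (hu : Continuous u) (hg : Continuous g) : ∃ B, 0 ≤ B ∧ ∀ x, ‖homExtGrad u g x‖ ≤ B := by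
  obtain ⟨B, hB⟩ := (isCompact_closedBall (0 : E) 1).exists_bound_of_continuousOn
    (f := fun ξ => u ξ • ξ + (g ξ - inner ℝ (g ξ) ξ • ξ)) (by fun_prop)
  refine ⟨B, (norm_nonneg _).trans (hB 0 (by simp)), fun x => ?_⟩
  refine hB _ ?_
  simp only [mem_closedBall_zero_iff, norm_smul, norm_inv, norm_norm]
  exact inv_mul_le_one

lemma exp_neg_sq_rotate (s : ℝ) (x y : E) :
    Real.exp (-‖Real.cos s • x + Real.sin s • y‖ ^ 2) *
      Real.exp (-‖Real.cos (s + Real.pi / 2) • x + Real.sin (s + Real.pi / 2) • y‖ ^ 2) =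
    Real.exp (-‖x‖ ^ 2) * Real.exp (-‖y‖ ^ 2) := by
  rw [← Real.exp_add, ← Real.exp_add]
  congr 1
  rw [Real.cos_add_pi_div_two, Real.sin_add_pi_div_two, norm_add_sq_real, norm_add_sq_real]
  simp only [norm_smul, inner_smul_left, inner_smul_right, norm_neg, mul_pow, Real.norm_eq_abs,
    sq_abs, conj_trivial]
  linear_combination (-‖x‖ ^ 2 - ‖y‖ ^ 2) * Real.sin_sq_add_cos_sq s

end homExt

section pairs
variable {E : Type*} [NormedAddCommGroup E] [InnerProductSpace ℝ E] [FiniteDimensional ℝ E]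
  [MeasurableSpace E] [BorelSpace E]

/-- Almost every pair of vectors is linearly independent, so the ellipse that it spans avoids the
origin, where `homExt` is not differentiable. -/
lemma ae_forall_cos_smul_add_sin_smul_ne_zero (hE : 2 ≤ Module.finrank ℝ E) :
    ∀ᵐ p : E × E, ∀ s : ℝ, Real.cos s • p.1 + Real.sin s • p.2 ≠ 0 := by
  have : Nontrivial E := Module.nontrivial_of_finrank_pos (R := ℝ) (by omega)
  have hmeas : MeasurableSet {p : E × E | inner ℝ p.1 p.2 ^ 2 = ‖p.1‖ ^ 2 * ‖p.2‖ ^ 2} :=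
    measurableSet_eq_fun (by fun_prop) (by fun_prop)
  have hnull : (volume : Measure (E × E))
      {p : E × E | inner ℝ p.1 p.2 ^ 2 = ‖p.1‖ ^ 2 * ‖p.2‖ ^ 2} = 0 := by
    rw [Measure.volume_eq_prod, Measure.measure_prod_null hmeas]
    filter_upwards [Measure.ae_ne volume (0 : E)] with x hx
    refine measure_mono_null ?_ (Measure.addHaar_submodule volume (Submodule.span ℝ {x}) ?_)
    · intro y (hy : inner ℝ x y ^ 2 = ‖x‖ ^ 2 * ‖y‖ ^ 2)
      by_cases hy0 : y = 0
      · subst hy0; simp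
      rw [← mul_pow, sq_eq_sq_iff_abs_eq_abs, abs_of_nonneg (by positivity : 0 ≤ ‖x‖ * ‖y‖)] at hy
      have h2 : ‖inner ℝ x y‖ = ‖x‖ * ‖y‖ := hy
      obtain ⟨r, -, hr⟩ := (norm_inner_eq_norm_iff hx hy0).1 h2
      rw [hr]
      exact Submodule.smul_mem _ _ (Submodule.mem_span_singleton_self x)
    · intro h
      have := finrank_span_singleton (K := ℝ) hx
      rw [h, finrank_top] at this
      omega
  refine measure_mono_null ?_ hnull
  intro p hp
  simp only [Set.mem_compl_iff, Set.mem_ofPred_eq, not_forall, not_not] at hp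
  obtain ⟨s, hs⟩ := hp
  have h1 : Real.cos s • p.1 = -(Real.sin s • p.2) := eq_neg_of_add_eq_zero_left hs
  have hx : Real.cos s ^ 2 * ‖p.1‖ ^ 2 = Real.sin s ^ 2 * ‖p.2‖ ^ 2 := by
    have := congrArg (‖·‖ ^ 2) h1
    simpa [norm_smul, mul_pow] using this
  have h2 : Real.cos s * ‖p.1‖ ^ 2 = -(Real.sin s * inner ℝ p.1 p.2) := by
    have := congrArg (inner ℝ p.1) h1
    simpa [inner_smul_right, inner_neg_right] using this
  have h3 : Real.cos s * inner ℝ p.1 p.2 = -(Real.sin s * ‖p.2‖ ^ 2) := by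
    have := congrArg (fun z => inner ℝ z p.2) h1
    simpa [inner_smul_left, inner_neg_left] using this
  have hcs := Real.sin_sq_add_cos_sq s
  simp only [Set.mem_ofPred_eq]
  set a := ‖p.1‖ ^ 2
  set b := ‖p.2‖ ^ 2
  set i := (inner ℝ p.1 p.2 : ℝ)
  set C := Real.cos s
  set S := Real.sin s
  -- `C (ab - i²) = 0` and `S (ab - i²) = 0`
  have h4 : C * (a * b - i ^ 2) = 0 := by linear_combination b * h2 - i * h3
  have h5 : S * (a * b - i ^ 2) = 0 := by linear_combination a * h3 - i * h2
  linear_combination (-1) * S * h5 - C * h4 + (a * b - i ^ 2) * hcs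

lemma lintegral_lintegral_rotate {H : E × E → ENNReal} (hH : Measurable H) :
    ∫⁻ p : E × E, ∫⁻ s in Set.Ioc 0 (2 * Real.pi), H (Real.cos s • p.1 + Real.sin s • p.2,
      Real.cos (s + Real.pi / 2) • p.1 + Real.sin (s + Real.pi / 2) • p.2) =
    ENNReal.ofReal (2 * Real.pi) * ∫⁻ p, H p := by
  rw [lintegral_lintegral_swap (by fun_prop)]
  have : ∀ s : ℝ, ∫⁻ p : E × E, H (Real.cos s • p.1 + Real.sin s • p.2,
      Real.cos (s + Real.pi / 2) • p.1 + Real.sin (s + Real.pi / 2) • p.2) = ∫⁻ p, H p :=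
    fun s => (measurePreserving_rotate E s).lintegral_comp hH
  simp_rw [this]
  simp [mul_comm]

/-- The Gaussian pair inequality: `E (f(y) - f(x))² ≤ 2 E (∇f(x)·y)²` for `f = homExt u`. Averaging
both sides over the rotations of the pair `(x, y)` reduces it to the Wirtinger inequality on the
ellipse spanned by `x` and `y`. -/
lemma lintegral_homExt_sub_sq_le (hE : 2 ≤ Module.finrank ℝ E) {u : E → ℝ} {g : E → E}
    (hu : ∀ x, HasGradientAt u (g x) x) (hg : Continuous g) :
    ∫⁻ p : E × E, ENNReal.ofReal ((homExt u p.2 - homExt u p.1) ^ 2 *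
      (Real.exp (-‖p.1‖ ^ 2) * Real.exp (-‖p.2‖ ^ 2))) ≤
    2 * ∫⁻ p : E × E, ENNReal.ofReal (inner ℝ (homExtGrad u g p.1) p.2 ^ 2 *
      (Real.exp (-‖p.1‖ ^ 2) * Real.exp (-‖p.2‖ ^ 2))) := by
  have huc : Continuous u := continuous_iff_continuousAt.2 fun x => (hu x).continuousAt
  have hm1 := measurable_homExt huc
  have hm2 := measurable_homExtGrad huc hg
  set A : E × E → ENNReal := fun p => ENNReal.ofReal ((homExt u p.2 - homExt u p.1) ^ 2 *
      (Real.exp (-‖p.1‖ ^ 2) * Real.exp (-‖p.2‖ ^ 2))) with hA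
  set B : E × E → ENNReal := fun p => ENNReal.ofReal (inner ℝ (homExtGrad u g p.1) p.2 ^ 2 *
      (Real.exp (-‖p.1‖ ^ 2) * Real.exp (-‖p.2‖ ^ 2))) with hB
  have hAm : Measurable A := by fun_prop
  have hBm : Measurable B := by fun_prop
  have hpi : ENNReal.ofReal (2 * Real.pi) ≠ 0 := by
    simpa using Real.two_pi_pos
  rw [← ENNReal.mul_le_mul_iff_right hpi ENNReal.ofReal_ne_top, ← lintegral_lintegral_rotate hAm,
    mul_left_comm, ← lintegral_lintegral_rotate hBm,
    ← lintegral_const_mul' _ _ (by simp)]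
  refine lintegral_mono_ae ?_
  filter_upwards [ae_forall_cos_smul_add_sin_smul_ne_zero hE] with p hp
  set c : ℝ → E := fun s => Real.cos s • p.1 + Real.sin s • p.2 with hc
  have hcd : ∀ s, HasDerivAt c (c (s + Real.pi / 2)) s := by
    intro s
    simp only [hc, Real.cos_add_pi_div_two, Real.sin_add_pi_div_two]
    exact ((Real.hasDerivAt_cos s).smul_const _).add ((Real.hasDerivAt_sin s).smul_const _)
  have hcc : Continuous c := by fun_prop
  set φ : ℝ → ℝ := fun s => homExt u (c s) with hφ
  set φ' : ℝ → ℝ := fun s => inner ℝ (homExtGrad u g (c s)) (c (s + Real.pi / 2)) with hφ'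
  have hd : ∀ s, HasDerivAt φ (φ' s) s := fun s => hasDerivAt_homExt_comp hu (hcd s) (hp s)
  have hφc : Continuous φ := continuous_iff_continuousAt.2 fun s => (hd s).continuousAt
  have hinv : Continuous fun s => ‖c s‖⁻¹ :=
    hcc.norm.inv₀ fun s => norm_ne_zero_iff.2 (hp s)
  have hφ'c : Continuous φ' := by
    simp only [hφ', homExtGrad]
    fun_prop
  have hper : Function.Periodic φ (2 * Real.pi) := fun s => by simp [hφ, hc]
  have key := integral_sub_quarter_shift_sq_le hper hd hφ'c
  set w := Real.exp (-‖p.1‖ ^ 2) * Real.exp (-‖p.2‖ ^ 2) with hw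
  have hw0 : 0 ≤ w := by positivity
  have eA : ∀ s, A (c s, c (s + Real.pi / 2)) =
      ENNReal.ofReal ((φ (s + Real.pi / 2) - φ s) ^ 2 * w) := by
    intro s
    simp only [hA, hc, exp_neg_sq_rotate, hφ, hw]
  have eB : ∀ s, B (c s, c (s + Real.pi / 2)) = ENNReal.ofReal (φ' s ^ 2 * w) := by
    intro s
    simp only [hB, hc, exp_neg_sq_rotate, hφ', hw]
  have conv : ∀ k : ℝ → ℝ, Continuous k → (∀ s, 0 ≤ k s) →
      ∫⁻ s in Set.Ioc 0 (2 * Real.pi), ENNReal.ofReal (k s) =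
        ENNReal.ofReal (∫ s in (0:ℝ)..(2 * Real.pi), k s) := by
    intro k hk h0
    rw [intervalIntegral.integral_of_le Real.two_pi_pos.le,
      ofReal_integral_eq_lintegral_ofReal (hk.integrableOn_Ioc) (ae_of_all _ h0)]
  calc _ = ∫⁻ s in Set.Ioc 0 (2 * Real.pi), A (c s, c (s + Real.pi / 2)) := rfl
    _ = ENNReal.ofReal (∫ s in (0:ℝ)..(2 * Real.pi), (φ (s + Real.pi / 2) - φ s) ^ 2 * w) := by
        simp_rw [eA]
        exact conv _ (by fun_prop) fun s => by positivity
    _ ≤ ENNReal.ofReal (2 * ∫ s in (0:ℝ)..(2 * Real.pi), φ' s ^ 2 * w) := by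
        refine ENNReal.ofReal_le_ofReal ?_
        rw [intervalIntegral.integral_mul_const w, intervalIntegral.integral_mul_const w]
        have h3 := mul_le_mul_of_nonneg_right key hw0
        rwa [mul_assoc] at h3
    _ = 2 * ∫⁻ s in Set.Ioc 0 (2 * Real.pi), B (c s, c (s + Real.pi / 2)) := by
        simp_rw [eB]
        rw [conv _ (by fun_prop) fun s => by positivity, ENNReal.ofReal_mul (by norm_num)]
        simp

end pairs

/-! ### The sharp Poincaré inequality on the sphere -/

section spherePoincare
variable {E : Type*} [NormedAddCommGroup E] [InnerProductSpace ℝ E] [FiniteDimensional ℝ E]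
  [MeasurableSpace E] [BorelSpace E] [Nontrivial E]

local notation "dim" => Module.finrank ℝ

/-- The integral of a function that separates in polar coordinates. -/
lemma integral_eq_integral_radial_mul_integral_sphere {k : E → ℝ} {a : ℝ → ℝ}
    {b : Metric.sphere (0 : E) 1 → ℝ} (hk : Integrable k)
    (h : ∀ r : ℝ, 0 < r → ∀ y : Metric.sphere (0 : E) 1, k (r • (y : E)) = a r * b y) :
    ∫ x, k x = (∫ r, a r ∂radialMeasure (dim E - 1)) *
      ∫ y, b y ∂(volume : Measure E).toSphere := by
  rw [integral_eq_integral_sphere_radial hk, ← integral_const_mul]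
  refine integral_congr_ae (ae_of_all _ fun y => ?_)
  simp only
  rw [← integral_mul_const]
  refine integral_congr_ae ?_
  filter_upwards [ae_radialMeasure_pos (dim E - 1)] with r hr using h r hr y

lemma integrable_norm_pow_mul_exp_neg_sq (k : ℕ) :
    Integrable fun x : E => ‖x‖ ^ k * Real.exp (-‖x‖ ^ 2) := by
  refine (integrable_fun_norm_addHaar volume (f := fun r => r ^ k * Real.exp (-r ^ 2))).2 ?_
  have h := integrable_rpow_mul_exp_neg_mul_sq (b := 1) one_pos
    (s := ((dim E - 1 + k : ℕ) : ℝ)) (by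
      have : (0:ℝ) ≤ ((dim E - 1 + k : ℕ) : ℝ) := Nat.cast_nonneg _
      linarith)
  refine h.integrableOn.congr_fun (fun r _ => ?_) measurableSet_Ioi
  simp only [Real.rpow_natCast, smul_eq_mul, pow_add]
  ring_nf

/-- The sharp Poincaré inequality on the unit sphere: for a function of mean zero on the sphere, the
integral of the squared tangential gradient is at least `dim E - 1` times that of its square. -/
lemma sphere_poincare (hE : 2 ≤ dim E) {u : E → ℝ} {g : E → E}
    (hu : ∀ x, HasGradientAt u (g x) x) (hg : Continuous g)
    (h0 : ∫ y : Metric.sphere (0 : E) 1, u y ∂(volume : Measure E).toSphere = 0) :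
    ((dim E : ℝ) - 1) * ∫ y : Metric.sphere (0 : E) 1, u y ^ 2 ∂(volume : Measure E).toSphere ≤
      ∫ y : Metric.sphere (0 : E) 1, (‖g y‖ ^ 2 - inner ℝ (g y) (y : E) ^ 2)
        ∂(volume : Measure E).toSphere := by
  have huc : Continuous u := continuous_iff_continuousAt.2 fun x => (hu x).continuousAt
  have hm1 := measurable_homExt huc
  have hm2 := measurable_homExtGrad huc hg
  obtain ⟨B, hB0, hB⟩ := exists_abs_homExt_le huc
  obtain ⟨B', hB'0, hB'⟩ := exists_norm_homExtGrad_le huc hg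
  set f := homExt u with hf
  set G := homExtGrad u g with hG
  set w : ℝ → ℝ := fun r => Real.exp (-r ^ 2) with hw
  have hwpos : ∀ r, 0 < w r := fun r => Real.exp_pos _
  have hwm : Measurable w := by fun_prop
  have hI : ∀ k : ℕ, Integrable fun x : E => ‖x‖ ^ k * w ‖x‖ :=
    integrable_norm_pow_mul_exp_neg_sq
  have hI0 : Integrable fun x : E => w ‖x‖ := by simpa using hI 0
  have i1 : Integrable fun x => f x * w ‖x‖ := by
    refine ((hI 1).const_mul B).mono' (by fun_prop) (ae_of_all _ fun x => ?_)
    rw [norm_mul, Real.norm_of_nonneg (hwpos _).le, pow_one, ← mul_assoc]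
    exact mul_le_mul_of_nonneg_right (hB x) (hwpos _).le
  have i2 : Integrable fun x => f x ^ 2 * w ‖x‖ := by
    refine ((hI 2).const_mul (B ^ 2)).mono' (by fun_prop) (ae_of_all _ fun x => ?_)
    rw [norm_mul, Real.norm_of_nonneg (hwpos _).le, ← mul_assoc, ← mul_pow, norm_pow]
    exact mul_le_mul_of_nonneg_right (pow_le_pow_left₀ (norm_nonneg _) (hB x) 2) (hwpos _).le
  have i3 : Integrable fun x => ‖G x‖ ^ 2 * w ‖x‖ := by
    refine (hI0.const_mul (B' ^ 2)).mono' (by fun_prop) (ae_of_all _ fun x => ?_)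
    rw [norm_mul, Real.norm_of_nonneg (hwpos _).le, norm_pow, norm_norm]
    exact mul_le_mul_of_nonneg_right (pow_le_pow_left₀ (norm_nonneg _) (hB' x) 2) (hwpos _).le
  have i4 : Integrable fun p : E × E => inner ℝ (G p.1) p.2 ^ 2 * (w ‖p.1‖ * w ‖p.2‖) := by
    refine ((hI0.const_mul (B' ^ 2)).mul_prod (hI 2)).mono'
      (by fun_prop) (ae_of_all _ fun p => ?_)
    have h1 : |inner ℝ (G p.1) p.2| ≤ B' * ‖p.2‖ :=
      (abs_real_inner_le_norm _ _).trans (mul_le_mul_of_nonneg_right (hB' _) (norm_nonneg _))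
    rw [norm_mul, norm_pow, Real.norm_eq_abs,
      Real.norm_of_nonneg (mul_nonneg (hwpos _).le (hwpos _).le)]
    calc _ ≤ (B' * ‖p.2‖) ^ 2 * (w ‖p.1‖ * w ‖p.2‖) :=
          mul_le_mul_of_nonneg_right (pow_le_pow_left₀ (abs_nonneg _) h1 2)
            (mul_nonneg (hwpos _).le (hwpos _).le)
      _ = _ := by ring
  have eqL : (fun p : E × E => (f p.2 - f p.1) ^ 2 * (w ‖p.1‖ * w ‖p.2‖)) = fun p =>
      w ‖p.1‖ * (f p.2 ^ 2 * w ‖p.2‖) - 2 * ((f p.1 * w ‖p.1‖) * (f p.2 * w ‖p.2‖)) +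
        (f p.1 ^ 2 * w ‖p.1‖) * w ‖p.2‖ := by
    ext p; ring
  have j1 := hI0.mul_prod i2
  have j2 := (i1.mul_prod i1).const_mul 2
  have j3 := i2.mul_prod hI0
  have i5 : Integrable fun p : E × E => (f p.2 - f p.1) ^ 2 * (w ‖p.1‖ * w ‖p.2‖) := by
    rw [eqL]; exact (j1.sub j2).add j3
  have hpair : ∫ p : E × E, (f p.2 - f p.1) ^ 2 * (w ‖p.1‖ * w ‖p.2‖) ≤
      2 * ∫ p : E × E, inner ℝ (G p.1) p.2 ^ 2 * (w ‖p.1‖ * w ‖p.2‖) := by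
    have hle := lintegral_homExt_sub_sq_le hE hu hg
    have p1 : ∀ p : E × E, 0 ≤ (f p.2 - f p.1) ^ 2 * (w ‖p.1‖ * w ‖p.2‖) := fun p =>
      mul_nonneg (sq_nonneg _) (mul_nonneg (hwpos _).le (hwpos _).le)
    have p2 : ∀ p : E × E, 0 ≤ inner ℝ (G p.1) p.2 ^ 2 * (w ‖p.1‖ * w ‖p.2‖) := fun p =>
      mul_nonneg (sq_nonneg _) (mul_nonneg (hwpos _).le (hwpos _).le)
    rw [← ENNReal.ofReal_le_ofReal_iff (mul_nonneg zero_le_two (integral_nonneg p2)),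
      ENNReal.ofReal_mul zero_le_two,
      ofReal_integral_eq_lintegral_ofReal i5 (ae_of_all _ p1),
      ofReal_integral_eq_lintegral_ofReal i4 (ae_of_all _ p2)]
    simpa using hle
  -- `R k` is the radial factor of the Gaussian integral of a `k`-homogeneous function;
  -- only `R 0` and `R 2` survive, and they occur on both sides
  set σ := (volume : Measure E).toSphere with hσ
  set R : ℕ → ℝ := fun k => ∫ r, r ^ k * w r ∂radialMeasure (dim E - 1) with hR
  have polar : ∀ (k : ℕ) (h : E → ℝ) (b : Metric.sphere (0 : E) 1 → ℝ), Integrable h →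
      (∀ r : ℝ, 0 < r → ∀ y : Metric.sphere (0 : E) 1, h (r • (y : E)) = r ^ k * w r * b y) →
      ∫ x, h x = R k * ∫ y, b y ∂σ := fun k h b hh hb =>
    integral_eq_integral_radial_mul_integral_sphere hh hb
  have e0 : ∫ x : E, w ‖x‖ = R 0 * ∫ y : Metric.sphere (0 : E) 1, (1:ℝ) ∂σ :=
    polar 0 _ _ hI0 fun r hr y => by simp [norm_smul_sphere hr]
  have e2 : ∫ x : E, ‖x‖ ^ 2 * w ‖x‖ = R 2 * ∫ y : Metric.sphere (0 : E) 1, (1:ℝ) ∂σ :=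
    polar 2 _ _ (hI 2) fun r hr y => by simp [norm_smul_sphere hr]
  have e1 : ∫ x, f x * w ‖x‖ = 0 := by
    rw [polar 1 _ (fun y => u y) i1 fun r hr y => ?_, h0, mul_zero]
    rw [hf, homExt, norm_inv_smul_smul_sphere hr, norm_smul_sphere hr]
    ring
  have e3 : ∫ x, f x ^ 2 * w ‖x‖ = R 2 * ∫ y : Metric.sphere (0 : E) 1, u y ^ 2 ∂σ := by
    refine polar 2 _ _ i2 fun r hr y => ?_
    rw [hf, homExt, norm_inv_smul_smul_sphere hr, norm_smul_sphere hr]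
    ring
  have e4 : ∫ x, ‖G x‖ ^ 2 * w ‖x‖ = R 0 * (∫ y : Metric.sphere (0 : E) 1, u y ^ 2 ∂σ +
      ∫ y : Metric.sphere (0 : E) 1, (‖g y‖ ^ 2 - inner ℝ (g y) (y : E) ^ 2) ∂σ) := by
    rw [← integral_add (integrable_sphere_of_continuous (by fun_prop))
      (integrable_sphere_of_continuous (by fun_prop))]
    refine polar 0 _ _ i3 fun r hr y => ?_
    rw [hG, homExtGrad, norm_inv_smul_smul_sphere hr, norm_smul_sphere hr,
      norm_homExtGrad_sq_of_norm_eq_one (by simp)]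
    ring
  -- the cross term vanishes since `f` has Gaussian mean zero
  have evL : ∫ p : E × E, (f p.2 - f p.1) ^ 2 * (w ‖p.1‖ * w ‖p.2‖) =
      2 * ((∫ x : E, w ‖x‖) * ∫ x, f x ^ 2 * w ‖x‖) := by
    rw [eqL]
    refine ((integral_add (j1.sub j2) j3).trans
      (congrArg (· + _) (integral_sub j1 j2))).trans ?_
    rw [integral_const_mul, integral_prod_mul (fun x : E => w ‖x‖) (fun x => f x ^ 2 * w ‖x‖),
      integral_prod_mul (fun x => f x * w ‖x‖) (fun x => f x * w ‖x‖),
      integral_prod_mul (fun x => f x ^ 2 * w ‖x‖) (fun x : E => w ‖x‖), e1]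
    ring
  have evR : (dim E : ℝ) * ∫ p : E × E, inner ℝ (G p.1) p.2 ^ 2 * (w ‖p.1‖ * w ‖p.2‖) =
      (∫ x, ‖G x‖ ^ 2 * w ‖x‖) * ∫ x : E, ‖x‖ ^ 2 * w ‖x‖ := by
    have hi : ∫ p : E × E, inner ℝ (G p.1) p.2 ^ 2 * (w ‖p.1‖ * w ‖p.2‖) =
      ∫ x, ∫ y, inner ℝ (G x) y ^ 2 * (w ‖x‖ * w ‖y‖) := integral_prod _ i4
    rw [hi, ← integral_const_mul, ← integral_mul_const]
    refine integral_congr_ae (ae_of_all _ fun x => ?_)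
    have := finrank_mul_integral_inner_sq_mul_eq w (hI 2) hwm (G x)
    simp only
    rw [mul_right_comm, ← this, mul_assoc, ← integral_mul_const]
    congr 2
    ext y
    ring
  have posZ : 0 < ∫ x : E, w ‖x‖ := integral_pos_iff_support_of_nonneg
    (fun x => (hwpos _).le) hI0 |>.2 (by
      have : (Function.support fun x : E => w ‖x‖) = Set.univ := by
        ext x; simp [(hwpos ‖x‖).ne']
      rw [this]
      exact isOpen_univ.measure_pos _ Set.univ_nonempty)
  have posM : 0 < ∫ x : E, ‖x‖ ^ 2 * w ‖x‖ := integral_pos_iff_support_of_nonneg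
    (fun x => mul_nonneg (sq_nonneg _) (hwpos _).le) (hI 2) |>.2 (by
      have : (Function.support fun x : E => ‖x‖ ^ 2 * w ‖x‖) = {0}ᶜ := by
        ext x; simp [(hwpos ‖x‖).ne']
      rw [this]
      exact isOpen_compl_singleton.measure_pos _ (exists_ne 0))
  set a := ∫ y : Metric.sphere (0 : E) 1, u y ^ 2 ∂σ
  set t := ∫ y : Metric.sphere (0 : E) 1, (‖g y‖ ^ 2 - inner ℝ (g y) (y : E) ^ 2) ∂σ
  set S := ∫ y : Metric.sphere (0 : E) 1, (1:ℝ) ∂σ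
  have hd : (0:ℝ) ≤ dim E := Nat.cast_nonneg _
  have key : (∫ x : E, w ‖x‖) * (∫ x : E, ‖x‖ ^ 2 * w ‖x‖) * ((dim E : ℝ) * a) ≤
      (∫ x : E, w ‖x‖) * (∫ x : E, ‖x‖ ^ 2 * w ‖x‖) * (a + t) := by
    have h1 := mul_le_mul_of_nonneg_left hpair hd
    rw [evL] at h1
    replace h1 : (dim E : ℝ) * ((∫ x : E, w ‖x‖) * ∫ x, f x ^ 2 * w ‖x‖) ≤
        (∫ x, ‖G x‖ ^ 2 * w ‖x‖) * ∫ x : E, ‖x‖ ^ 2 * w ‖x‖ := by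
      rw [← evR]; linarith
    rw [e3, e4] at h1
    have hS : 0 ≤ S := integral_nonneg fun _ => zero_le_one
    have h2 := mul_le_mul_of_nonneg_right h1 hS
    rw [e2, e0] at h2 ⊢
    linarith
  have := le_of_mul_le_mul_left key (mul_pos posZ posM)
  linarith

end spherePoincare

/-! ### The Hardy inequality with remainder -/

lemma integrable_of_bounded_of_vanishing {F : Type*} [NormedAddCommGroup F] [ProperSpace F]
    [MeasurableSpace F] {μ : Measure F} [IsFiniteMeasureOnCompacts μ] {f : F → ℝ}
    [OpensMeasurableSpace F]
    (hf : Measurable f) {R C : ℝ} (hR : ∀ x, R < ‖x‖ → f x = 0) (hC : ∀ x, ‖x‖ ≤ R → |f x| ≤ C) :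
    Integrable f μ := by
  rw [← integrableOn_iff_integrable_of_support_subset (s := Metric.closedBall (0 : F) R)]
  · refine Measure.integrableOn_of_bounded (M := C)
      (isCompact_closedBall (0 : F) R).measure_lt_top.ne hf.aestronglyMeasurable ?_
    filter_upwards [ae_restrict_mem Metric.isClosed_closedBall.measurableSet] with x hx
    exact hC x (by simpa using hx)
  · intro x hx
    by_contra h
    exact hx (hR x (by simpa using h))

lemma mul_exp_neg_le_one (r : ℝ) : r * Real.exp (-r) ≤ 1 := by
  rw [Real.exp_neg]
  refine mul_inv_le_one_of_le₀ ?_ (Real.exp_pos _).le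
  linarith [Real.add_one_le_exp r]

section hardy
variable {E : Type*} [NormedAddCommGroup E] [InnerProductSpace ℝ E] [FiniteDimensional ℝ E]

local notation "dim" => Module.finrank ℝ

lemma inner_sq_div_norm_sq_le {E : Type*} [NormedAddCommGroup E] [InnerProductSpace ℝ E]
    (a x : E) : inner ℝ a x ^ 2 / ‖x‖ ^ 2 ≤ ‖a‖ ^ 2 := by
  refine div_le_of_le_mul₀ (by positivity) (by positivity) ?_
  rw [← mul_pow, ← sq_abs]
  exact pow_le_pow_left₀ (abs_nonneg _) (abs_real_inner_le_norm _ _) 2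

/-- `u` is continuously differentiable with gradient `g`, has compact support, and vanishes at the
origin. The last condition makes `|u|²/|x|²` bounded, also in dimensions one and two. The gradient
is a parameter, so that it can be given by a formula. -/
structure IsTestPair (u : E → ℝ) (g : E → E) : Prop where
  hasGradientAt : ∀ x, HasGradientAt u (g x) x
  continuous_grad : Continuous g
  compactSupport : HasCompactSupport u
  zero : u 0 = 0

/-- The function `x·∇u + (dim E - 2)/2 u`, where `g` stands for `∇u`: the derivative at `t = 1` of
`t ^ ((dim E - 2)/2) u(t x)`. These dilations are unitary in `L²(dx/|x|²)` and preserve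
`∫ |∇u|²`. -/
noncomputable def dilGen (u : E → ℝ) (g : E → E) (x : E) : ℝ :=
  inner ℝ (g x) x + ((dim E : ℝ) - 2) / 2 * u x

namespace IsTestPair
variable {u : E → ℝ} {g : E → E} (h : IsTestPair u g)
include h

lemma continuous : Continuous u :=
  continuous_iff_continuousAt.2 fun x => (h.hasGradientAt x).continuousAt

lemma grad_eq_zero {x : E} (hx : x ∉ tsupport u) : g x = 0 := by
  have h1 : u =ᶠ[𝓝 x] fun _ => 0 := notMem_tsupport_iff_eventuallyEq.1 hx
  have h2 : HasGradientAt u 0 x := (hasGradientAt_const x (0:ℝ)).congr_of_eventuallyEq h1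
  exact (h.hasGradientAt x).unique h2

lemma exists_bounds : ∃ R L : ℝ, 0 ≤ R ∧ 0 ≤ L ∧ (∀ x, R < ‖x‖ → u x = 0) ∧
    (∀ x, R < ‖x‖ → g x = 0) ∧ (∀ x, ‖g x‖ ≤ L) ∧ ∀ x, |u x| ≤ L * ‖x‖ := by
  obtain ⟨R, hR⟩ := h.compactSupport.isBounded.exists_norm_le
  obtain ⟨L, hL⟩ := h.compactSupport.exists_bound_of_continuousOn h.continuous_grad.continuousOn
  have hL' : ∀ x, ‖g x‖ ≤ max L 0 := by
    intro x
    by_cases hx : x ∈ tsupport u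
    · exact (hL x hx).trans (le_max_left _ _)
    · rw [h.grad_eq_zero hx, norm_zero]; exact le_max_right _ _
  have hn : ∀ x, max R 0 < ‖x‖ → x ∉ tsupport u := fun x hx hx' =>
    absurd (hR x hx') (not_le.2 ((le_max_left _ _).trans_lt hx))
  refine ⟨max R 0, max L 0, le_max_right _ _, le_max_right _ _,
    fun x hx => image_eq_zero_of_notMem_tsupport (hn x hx), fun x hx => h.grad_eq_zero (hn x hx),
    hL', fun x => ?_⟩
  have := convex_univ.norm_image_sub_le_of_norm_hasFDerivWithin_le (x := (0 : E)) (y := x)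
    (fun z _ => (h.hasGradientAt z).hasFDerivAt.hasFDerivWithinAt)
    (fun z _ => by rw [LinearIsometryEquiv.norm_map]; exact hL' z) (Set.mem_univ _) (Set.mem_univ _)
  simpa [h.zero] using this

/-- The integrand `2 u L u / |x|²`, with `L u` the dilation generator, is bounded and has bounded
support, since `u` and `L u` are both `O(|x|)`. -/
lemma exists_cross_bounds : ∃ R C : ℝ, 0 ≤ R ∧ 0 ≤ C ∧
    (∀ x, R < ‖x‖ → 2 * u x * dilGen u g x / ‖x‖ ^ 2 = 0) ∧
    ∀ x, |2 * u x * dilGen u g x / ‖x‖ ^ 2| ≤ C := by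
  obtain ⟨R, L, hR, hL, h1, h2, h3, h4⟩ := h.exists_bounds
  refine ⟨R, 2 * L * (L + |((dim E : ℝ) - 2) / 2| * L), hR, by positivity,
    fun x hx => by rw [h1 x hx]; simp, fun x => ?_⟩
  rw [abs_div, abs_mul, abs_mul, abs_two, abs_of_nonneg (sq_nonneg ‖x‖)]
  refine div_le_of_le_mul₀ (by positivity) (by positivity) ?_
  have h5 : |dilGen u g x| ≤ (L + |((dim E : ℝ) - 2) / 2| * L) * ‖x‖ := by
    unfold dilGen
    refine (abs_add_le _ _).trans ?_
    rw [add_mul, abs_mul, mul_assoc]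
    refine add_le_add ((abs_real_inner_le_norm _ _).trans ?_) ?_
    · exact mul_le_mul_of_nonneg_right (h3 x) (norm_nonneg _)
    · exact mul_le_mul_of_nonneg_left (h4 x) (abs_nonneg _)
  calc 2 * |u x| * |dilGen u g x| ≤ 2 * (L * ‖x‖) *
        ((L + |((dim E : ℝ) - 2) / 2| * L) * ‖x‖) := by
        gcongr
        exact h4 x
    _ = _ := by ring

section integrable
variable [MeasurableSpace E] [BorelSpace E]

lemma measurable : Measurable u := h.continuous.measurable

lemma measurable_grad : Measurable g := h.continuous_grad.measurable

lemma measurable_dilGen : Measurable (dilGen u g) := by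
  have := h.measurable
  have := h.measurable_grad
  unfold dilGen
  fun_prop

lemma integrable_hardy : Integrable fun x => u x ^ 2 / ‖x‖ ^ 2 := by
  obtain ⟨R, L, hR, hL, h1, h2, h3, h4⟩ := h.exists_bounds
  have := h.measurable
  refine integrable_of_bounded_of_vanishing (C := L ^ 2) (by fun_prop)
    (fun x hx => by rw [h1 x hx]; simp) fun x _ => ?_
  rw [abs_of_nonneg (by positivity)]
  refine div_le_of_le_mul₀ (by positivity) (by positivity) ?_
  rw [← mul_pow, ← sq_abs]
  exact pow_le_pow_left₀ (abs_nonneg _) (h4 x) 2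

lemma integrable_grad : Integrable fun x => ‖g x‖ ^ 2 := by
  obtain ⟨R, L, hR, hL, h1, h2, h3, h4⟩ := h.exists_bounds
  have := h.measurable_grad
  refine integrable_of_bounded_of_vanishing (C := L ^ 2) (by fun_prop)
    (fun x hx => by rw [h2 x hx]; simp) fun x _ => ?_
  rw [abs_of_nonneg (by positivity)]
  exact pow_le_pow_left₀ (norm_nonneg _) (h3 x) 2

lemma integrable_radial : Integrable fun x => inner ℝ (g x) x ^ 2 / ‖x‖ ^ 2 := by
  have := h.measurable_grad
  refine h.integrable_grad.mono' (Measurable.aestronglyMeasurable (by fun_prop))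
    (ae_of_all _ fun x => ?_)
  rw [Real.norm_of_nonneg (by positivity)]
  exact inner_sq_div_norm_sq_le _ _

lemma measurable_cross : Measurable fun x => 2 * u x * dilGen u g x / ‖x‖ ^ 2 := by
  have := h.measurable
  have := h.measurable_dilGen
  fun_prop

lemma integrable_cross : Integrable fun x => 2 * u x * dilGen u g x / ‖x‖ ^ 2 := by
  obtain ⟨R, C, hR, hC, h1, h2⟩ := h.exists_cross_bounds
  exact integrable_of_bounded_of_vanishing h.measurable_cross h1 fun x _ => h2 x

lemma integrable_ray (n : ℕ) (y : Metric.sphere (0 : E) 1) :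
    Integrable fun s : ℝ => s ^ n *
      (2 * u (s • y) * dilGen u g (s • (y : E)) / ‖s • (y : E)‖ ^ 2) := by
  obtain ⟨R, C, hR, hC, h1, h2⟩ := h.exists_cross_bounds
  have hm := h.measurable_cross
  have hm' : Measurable fun s : ℝ => s • (y : E) := by fun_prop
  have hn : ∀ s : ℝ, ‖s • (y : E)‖ = ‖s‖ := fun s => by simp [norm_smul]
  refine integrable_of_bounded_of_vanishing (R := R) (C := R ^ n * C)
    ((measurable_id.pow_const n).mul (hm.comp hm')) (fun s hs => ?_) fun s hs => ?_
  · rw [h1 _ (by rwa [hn]), mul_zero]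
  · rw [abs_mul, abs_pow]
    exact mul_le_mul (pow_le_pow_left₀ (abs_nonneg _) hs n) (h2 _) (abs_nonneg _) (by positivity)

/-- Along a ray, `2 u L u r ^ (dim E - 3)` is the derivative of `u² r ^ (dim E - 2)`. The power is
written as `a ^ dim E / a ^ 2` to avoid negative exponents; at `a = 0` the right-hand side is `0`,
which is also the limit, as `u` vanishes at the origin. -/
lemma integral_Ioi_ray [Nontrivial E] (y : Metric.sphere (0 : E) 1) {a : ℝ} (ha : 0 ≤ a) :
    ∫ s in Set.Ioi a, s ^ (dim E - 1) *
      (2 * u (s • y) * dilGen u g (s • (y : E)) / ‖s • (y : E)‖ ^ 2) =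
    -(u (a • y) ^ 2 * a ^ dim E / a ^ 2) := by
  obtain ⟨R, L, hR, hL, h1, h2, h3, h4⟩ := h.exists_bounds
  obtain ⟨n, hn⟩ : ∃ n, dim E = n + 1 :=
    Nat.exists_eq_succ_of_ne_zero (Module.finrank_pos (R := ℝ) (M := E)).ne'
  have hny : ∀ s : ℝ, ‖s • (y : E)‖ = |s| := fun s => by simp [norm_smul]
  set F : ℝ → ℝ := fun s => u (s • y) ^ 2 * s ^ dim E / s ^ 2 with hF
  have hFle : ∀ s, |F s| ≤ L ^ 2 * |s| ^ dim E := by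
    intro s
    simp only [hF]
    rw [abs_div, abs_mul, abs_pow, abs_pow, abs_pow]
    refine div_le_of_le_mul₀ (by positivity) (by positivity) ?_
    have := pow_le_pow_left₀ (abs_nonneg _) (h4 (s • y)) 2
    rw [hny] at this
    calc _ ≤ (L * |s|) ^ 2 * |s| ^ dim E := by gcongr
      _ = _ := by ring
  have hcont : ContinuousWithinAt F (Set.Ici a) a := by
    rcases ha.eq_or_lt with rfl | ha
    · have hF0 : F 0 = 0 := by simp [hF]
      refine ContinuousAt.continuousWithinAt ?_
      rw [ContinuousAt, hF0]
      refine squeeze_zero_norm (a := fun s => L ^ 2 * |s| ^ dim E) hFle ?_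
      have : Continuous fun s : ℝ => L ^ 2 * |s| ^ dim E := by fun_prop
      simpa [hn] using this.tendsto 0
    · refine ContinuousAt.continuousWithinAt ?_
      have := h.continuous
      exact ContinuousAt.div (by fun_prop) (by fun_prop) (by positivity)
  have hderiv : ∀ s ∈ Set.Ioi a, HasDerivAt F (s ^ (dim E - 1) *
      (2 * u (s • y) * dilGen u g (s • (y : E)) / ‖s • (y : E)‖ ^ 2)) s := by
    intro s (hs : a < s)
    have hs0 : s ≠ 0 := (ha.trans_lt hs).ne'
    have d1 : HasDerivAt (fun s : ℝ => s • (y : E)) ((1:ℝ) • (y : E)) s :=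
      (hasDerivAt_id s).smul_const _
    have d2 := (h.hasGradientAt (s • y)).hasFDerivAt.comp_hasDerivAt s d1
    have d3 := ((d2.pow 2).mul (hasDerivAt_pow (dim E) s)).div (hasDerivAt_pow 2 s)
      (pow_ne_zero 2 hs0)
    refine d3.congr_deriv ?_
    simp only [Function.comp_apply, InnerProductSpace.toDual_apply_apply, one_smul, dilGen,
      inner_smul_right, hny, sq_abs, hn, Nat.add_sub_cancel, Pi.pow_apply, Pi.mul_apply]
    field_simp
    push_cast
    ring
  rw [integral_Ioi_of_hasDerivAt_of_tendsto hcont hderiv (h.integrable_ray _ y).integrableOn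
    (m := 0), zero_sub]
  refine tendsto_const_nhds.congr' ?_
  filter_upwards [eventually_gt_atTop R, eventually_gt_atTop 0] with s hs hs0
  simp only [hF]
  rw [h1 _ (by rw [hny, abs_of_pos hs0]; exact hs)]
  simp

lemma integral_cross_eq_zero [Nontrivial E] : ∫ x, 2 * u x * dilGen u g x / ‖x‖ ^ 2 = 0 := by
  rw [integral_eq_integral_sphere_radial h.integrable_cross]
  refine integral_eq_zero_of_ae (ae_of_all _ fun y => ?_)
  simp only
  rw [integral_radialMeasure, h.integral_Ioi_ray y le_rfl]
  simp

/-- The integral over a ray bounds `u² r ^ (dim E - 2)` at each of its points, and the weight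
`|x| e ^ (-|x|)` has integral one with respect to `dr / r`. -/
lemma integral_weighted_le [Nontrivial E] :
    ∫ x, ‖x‖ * Real.exp (-‖x‖) * (u x ^ 2 / ‖x‖ ^ 2) ≤
      ∫ x, |2 * u x * dilGen u g x / ‖x‖ ^ 2| := by
  have hm := h.measurable
  have hint : Integrable fun x => ‖x‖ * Real.exp (-‖x‖) * (u x ^ 2 / ‖x‖ ^ 2) := by
    refine h.integrable_hardy.mono' (by fun_prop) (ae_of_all _ fun x => ?_)
    rw [Real.norm_of_nonneg (by positivity)]
    exact mul_le_of_le_one_left (by positivity) (mul_exp_neg_le_one _)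
  have hP := measurePreserving_polar E
  have hK := h.integrable_cross.abs
  rw [integral_eq_integral_sphere_radial hint, integral_eq_integral_sphere_radial hK]
  refine integral_mono_of_nonneg (ae_of_all _ fun y => integral_nonneg_of_ae ?_)
    ((hP.integrable_comp hK.aestronglyMeasurable).2 hK).integral_prod_left
    (ae_of_all _ fun y => ?_)
  · filter_upwards with r
    simp only [Pi.zero_apply]
    positivity
  simp only
  rw [integral_radialMeasure, integral_radialMeasure]
  set J := ∫ s in Set.Ioi (0:ℝ), s ^ (dim E - 1) *
    |2 * u (s • y) * dilGen u g (s • (y : E)) / ‖s • (y : E)‖ ^ 2| with hJ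
  have hk := (h.integrable_ray (dim E - 1) y).abs
  have hJ' : ∀ a : ℝ, 0 ≤ a → u (a • y) ^ 2 * a ^ dim E / a ^ 2 ≤ J := by
    intro a ha
    have e1 := h.integral_Ioi_ray y ha
    have e2 : J = ∫ s in Set.Ioi (0:ℝ), |s ^ (dim E - 1) *
      (2 * u (s • y) * dilGen u g (s • (y : E)) / ‖s • (y : E)‖ ^ 2)| :=
      setIntegral_congr_fun measurableSet_Ioi fun s (hs : 0 < s) => by
        rw [abs_mul, abs_of_nonneg (pow_nonneg hs.le _)]
    rw [← neg_le_neg_iff, ← e1, e2]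
    refine (neg_le_neg (setIntegral_mono_set hk.integrableOn (ae_of_all _ fun _ => abs_nonneg _)
      (Set.Ioi_subset_Ioi ha).eventuallyLE)).trans ?_
    exact neg_le_of_abs_le (abs_integral_le_integral_abs)
  calc _ ≤ ∫ r in Set.Ioi (0:ℝ), Real.exp (-r) * J := by
        refine integral_mono_of_nonneg ?_ ((integrableOn_exp_neg_Ioi 0).mul_const J) ?_
        · filter_upwards [ae_restrict_mem measurableSet_Ioi] with r (hr : 0 < r)
          simp only [Pi.zero_apply]
          positivity
        · filter_upwards [ae_restrict_mem measurableSet_Ioi] with r (hr : 0 < r)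
          rw [norm_smul_sphere hr]
          refine le_trans (le_of_eq ?_)
            (mul_le_mul_of_nonneg_left (hJ' r hr.le) (Real.exp_pos (-r)).le)
          obtain ⟨n, hn⟩ : ∃ n, dim E = n + 1 :=
            Nat.exists_eq_succ_of_ne_zero (Module.finrank_pos (R := ℝ) (M := E)).ne'
          rw [hn, Nat.add_sub_cancel]
          ring
    _ = J := by rw [integral_mul_const, integral_exp_neg_Ioi_zero, one_mul]

/-- The spherical Poincaré inequality on all spheres, integrated over the radius: the tangential
part of the Dirichlet integral. -/
lemma tangential_ge [Nontrivial E]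
    (hmean : ∀ r : ℝ, 0 < r → ∫ y : Metric.sphere (0 : E) 1, u (r • (y : E))
      ∂(volume : Measure E).toSphere = 0) :
    ((dim E : ℝ) - 1) * ∫ x, u x ^ 2 / ‖x‖ ^ 2 ≤
      ∫ x, (‖g x‖ ^ 2 - inner ℝ (g x) x ^ 2 / ‖x‖ ^ 2) := by
  rcases (Nat.succ_le_of_lt (Module.finrank_pos (R := ℝ) (M := E))).eq_or_lt with hd | hd
  · rw [← hd]
    simp only [Nat.succ_eq_add_one, zero_add, Nat.cast_one, sub_self, zero_mul]
    refine integral_nonneg fun x => ?_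
    exact sub_nonneg.2 (inner_sq_div_norm_sq_le _ _)
  have i1 : Integrable fun x => ‖g x‖ ^ 2 - inner ℝ (g x) x ^ 2 / ‖x‖ ^ 2 :=
    h.integrable_grad.sub h.integrable_radial
  have i2 := h.integrable_hardy.const_mul ((dim E : ℝ) - 1)
  have i3 : Integrable fun x => ‖g x‖ ^ 2 - inner ℝ (g x) x ^ 2 / ‖x‖ ^ 2 -
      ((dim E : ℝ) - 1) * (u x ^ 2 / ‖x‖ ^ 2) := i1.sub i2
  rw [← sub_nonneg, ← integral_const_mul, ← integral_sub i1 i2,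
    integral_eq_integral_radial_sphere i3]
  refine integral_nonneg_of_ae ?_
  filter_upwards [ae_radialMeasure_pos (dim E - 1)] with r hr
  have huc := h.continuous
  have hgc := h.continuous_grad
  have hgrad : ∀ x, HasGradientAt (fun x => u (r • x)) (r • g (r • x)) x := by
    intro x
    have h1 : HasFDerivAt (fun x : E => r • x) (r • ContinuousLinearMap.id ℝ E) x :=
      (hasFDerivAt_id x).const_smul r
    have h2 := (h.hasGradientAt (r • x)).hasFDerivAt.comp x h1
    rw [hasGradientAt_iff_hasFDerivAt]
    refine h2.congr_fderiv ?_
    ext z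
    simp
  have key := sphere_poincare hd hgrad (by fun_prop) (hmean r hr)
  rw [← sub_nonneg, ← integral_const_mul, ← integral_sub
    (integrable_sphere_of_continuous (by fun_prop))
    (integrable_sphere_of_continuous (by fun_prop))] at key
  have key2 := mul_nonneg (inv_nonneg.2 (sq_nonneg r)) key
  rw [← integral_const_mul] at key2
  refine key2.trans (le_of_eq (integral_congr_ae (ae_of_all _ fun y => ?_)))
  simp only
  rw [norm_smul_sphere hr, norm_smul, inner_smul_left, inner_smul_right, conj_trivial,
    Real.norm_eq_abs, mul_pow, sq_abs]
  field_simp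

/-- The Hardy inequality with constant `(dim E)²/4` for functions with vanishing spherical means,
with the remainder that comes from the radial derivative. -/
theorem hardy_remainder [Nontrivial E]
    (hmean : ∀ r : ℝ, 0 < r → ∫ y : Metric.sphere (0 : E) 1, u (r • (y : E))
      ∂(volume : Measure E).toSphere = 0) :
    (dim E : ℝ) ^ 2 / 4 * (∫ x, u x ^ 2 / ‖x‖ ^ 2) + ∫ x, dilGen u g x ^ 2 / ‖x‖ ^ 2 ≤
      ∫ x, ‖g x‖ ^ 2 := by
  have hA := h.tangential_ge hmean
  rw [integral_sub h.integrable_grad h.integrable_radial] at hA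
  have hB : ∫ x, dilGen u g x ^ 2 / ‖x‖ ^ 2 = (∫ x, inner ℝ (g x) x ^ 2 / ‖x‖ ^ 2) -
      ((dim E : ℝ) - 2) ^ 2 / 4 * ∫ x, u x ^ 2 / ‖x‖ ^ 2 := by
    have i1 := h.integrable_hardy.const_mul (((dim E : ℝ) - 2) ^ 2 / 4)
    have i2 := h.integrable_cross.const_mul (((dim E : ℝ) - 2) / 2)
    have e : ∀ x, dilGen u g x ^ 2 / ‖x‖ ^ 2 = (inner ℝ (g x) x ^ 2 / ‖x‖ ^ 2 -
        ((dim E : ℝ) - 2) ^ 2 / 4 * (u x ^ 2 / ‖x‖ ^ 2)) +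
        ((dim E : ℝ) - 2) / 2 * (2 * u x * dilGen u g x / ‖x‖ ^ 2) := by
      intro x
      unfold dilGen
      ring
    have i3 : Integrable fun x => inner ℝ (g x) x ^ 2 / ‖x‖ ^ 2 -
        ((dim E : ℝ) - 2) ^ 2 / 4 * (u x ^ 2 / ‖x‖ ^ 2) := h.integrable_radial.sub i1
    simp_rw [e]
    rw [integral_add i3 i2, integral_sub h.integrable_radial i1,
      integral_const_mul, integral_const_mul, h.integral_cross_eq_zero]
    ring
  rw [hB]
  linarith

lemma integrable_dilGen_sq : Integrable fun x => dilGen u g x ^ 2 / ‖x‖ ^ 2 := by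
  have := h.measurable_dilGen
  refine ((h.integrable_radial.const_mul 2).add
    (h.integrable_hardy.const_mul (2 * (((dim E : ℝ) - 2) / 2) ^ 2))).mono'
    (Measurable.aestronglyMeasurable (by fun_prop)) (ae_of_all _ fun x => ?_)
  rw [Real.norm_of_nonneg (by positivity)]
  simp only [Pi.add_apply]
  rw [mul_div_assoc', mul_div_assoc', ← add_div]
  refine div_le_div_of_nonneg_right ?_ (sq_nonneg _)
  unfold dilGen
  nlinarith [sq_nonneg (inner ℝ (g x) x - ((dim E : ℝ) - 2) / 2 * u x)]

/-- The deficit in the Hardy inequality controls a weighted norm of `u`. This form of the remainder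
is stable under passage to the completion. -/
theorem integral_weighted_le_of_pos [Nontrivial E]
    (hmean : ∀ r : ℝ, 0 < r → ∫ y : Metric.sphere (0 : E) 1, u (r • (y : E))
      ∂(volume : Measure E).toSphere = 0) {ε : ℝ} (hε : 0 < ε) :
    ∫ x, ‖x‖ * Real.exp (-‖x‖) * (u x ^ 2 / ‖x‖ ^ 2) ≤
      ε * (∫ x, u x ^ 2 / ‖x‖ ^ 2) +
        ε⁻¹ * ((∫ x, ‖g x‖ ^ 2) - (dim E : ℝ) ^ 2 / 4 * ∫ x, u x ^ 2 / ‖x‖ ^ 2) := by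
  have h1 : ∫ x, |2 * u x * dilGen u g x / ‖x‖ ^ 2| ≤
      ∫ x, (ε * (u x ^ 2 / ‖x‖ ^ 2) + ε⁻¹ * (dilGen u g x ^ 2 / ‖x‖ ^ 2)) := by
    refine integral_mono h.integrable_cross.abs
      ((h.integrable_hardy.const_mul ε).add (h.integrable_dilGen_sq.const_mul ε⁻¹)) fun x => ?_
    simp only
    rw [mul_div_assoc', mul_div_assoc', ← add_div, abs_div, abs_of_nonneg (sq_nonneg ‖x‖)]
    refine div_le_div_of_nonneg_right ?_ (sq_nonneg _)
    rw [abs_mul, abs_mul, abs_two]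
    have h2 : ε * u x ^ 2 + ε⁻¹ * dilGen u g x ^ 2 - 2 * |u x| * |dilGen u g x| =
        ε⁻¹ * (ε * |u x| - |dilGen u g x|) ^ 2 := by
      rw [← sq_abs (u x), ← sq_abs (dilGen u g x)]
      field_simp
      ring
    have h3 : 0 ≤ ε⁻¹ * (ε * |u x| - |dilGen u g x|) ^ 2 := by positivity
    linarith
  rw [integral_add (h.integrable_hardy.const_mul ε) (h.integrable_dilGen_sq.const_mul ε⁻¹),
    integral_const_mul, integral_const_mul] at h1
  have h4 := h.hardy_remainder hmean
  have h5 := mul_le_mul_of_nonneg_left (le_sub_iff_add_le'.2 h4) (inv_nonneg.2 hε.le)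
  linarith [h.integral_weighted_le]

end integrable
end IsTestPair
end hardy

/-! ### Strictness in the completion -/

lemma norm_toLp_two_sq {α F : Type*} [MeasurableSpace α] {μ : Measure α} [NormedAddCommGroup F]
    [InnerProductSpace ℝ F] {f : α → F} (hf : MemLp f 2 μ) :
    ‖hf.toLp f‖ ^ 2 = ∫ x, ‖f x‖ ^ 2 ∂μ := by
  rw [← real_inner_self_eq_norm_sq, L2.inner_def]
  refine integral_congr_ae ?_
  filter_upwards [hf.coeFn_toLp] with x hx
  rw [hx, real_inner_self_eq_norm_sq]

section completion
variable {E : Type*} [NormedAddCommGroup E] [InnerProductSpace ℝ E] [FiniteDimensional ℝ E]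

local notation "dim" => Module.finrank ℝ

lemma IsTestPair.sub {u v : E → ℝ} {g k : E → E} (hu : IsTestPair u g) (hv : IsTestPair v k) :
    IsTestPair (fun x => u x - v x) (fun x => g x - k x) where
  hasGradientAt x := by
    rw [hasGradientAt_iff_hasFDerivAt, map_sub]
    exact (hu.hasGradientAt x).hasFDerivAt.sub (hv.hasGradientAt x).hasFDerivAt
  continuous_grad := hu.continuous_grad.sub hv.continuous_grad
  compactSupport := hu.compactSupport.sub hv.compactSupport
  zero := by simp [hu.zero, hv.zero]

variable [MeasurableSpace E] [BorelSpace E]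

lemma IsTestPair.memLp_grad {u : E → ℝ} {g : E → E} (h : IsTestPair u g) : MemLp g 2 :=
  (memLp_two_iff_integrable_sq_norm h.measurable_grad.aestronglyMeasurable).2 h.integrable_grad

lemma IsTestPair.memLp_div_norm {u : E → ℝ} {g : E → E} (h : IsTestPair u g) :
    MemLp (fun x => u x / ‖x‖) 2 := by
  have := h.measurable
  refine (memLp_two_iff_integrable_sq (Measurable.aestronglyMeasurable (by fun_prop))).2 ?_
  simpa only [div_pow] using h.integrable_hardy

/-- The Hardy inequality is strict in the completion with respect to the norm `‖∇ ·‖_{L²}`. The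
inequality applied to differences shows that `φ k / |x|` is a Cauchy sequence in `L²`; if the limit
attained the constant, the weighted estimate would force it to vanish. -/
theorem hardy_strict_of_tendsto [Nontrivial E] {φ : ℕ → E → ℝ} {g : ℕ → E → E}
    (hφ : ∀ k, IsTestPair (φ k) (g k))
    (hmean : ∀ k, ∀ r : ℝ, 0 < r → ∫ y : Metric.sphere (0 : E) 1, φ k (r • (y : E))
      ∂(volume : Measure E).toSphere = 0)
    {u : E → ℝ} {G : E → E} (hG : MemLp G 2)
    (hu : ∀ᵐ x, Tendsto (fun k => φ k x) atTop (𝓝 (u x)))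
    (hgG : Tendsto (fun k => eLpNorm (fun x => g k x - G x) 2) atTop (𝓝 0))
    (hu0 : ¬ (u =ᵐ[volume] 0)) :
    Integrable (fun x => u x ^ 2 / ‖x‖ ^ 2) ∧
      (dim E : ℝ) ^ 2 / 4 * (∫ x, u x ^ 2 / ‖x‖ ^ 2) < ∫ x, ‖G x‖ ^ 2 := by
  have hd : (0:ℝ) < dim E := Nat.cast_pos.2 Module.finrank_pos
  set a : ℕ → Lp E 2 (volume : Measure E) := fun k => (hφ k).memLp_grad.toLp with ha
  set b : ℕ → Lp ℝ 2 (volume : Measure E) := fun k => (hφ k).memLp_div_norm.toLp with hb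
  have hna : ∀ k, ‖a k‖ ^ 2 = ∫ x, ‖g k x‖ ^ 2 := fun k => norm_toLp_two_sq _
  have hnb : ∀ k, ‖b k‖ ^ 2 = ∫ x, φ k x ^ 2 / ‖x‖ ^ 2 := by
    intro k
    refine (norm_toLp_two_sq _).trans (integral_congr_ae (ae_of_all _ fun x => ?_))
    simp only [norm_div, div_pow, Real.norm_eq_abs, sq_abs]
  have hmean' : ∀ k l, ∀ r : ℝ, 0 < r → ∫ y : Metric.sphere (0 : E) 1,
      (φ k (r • (y : E)) - φ l (r • (y : E))) ∂(volume : Measure E).toSphere = 0 := by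
    intro k l r hr
    have cint : ∀ k, Integrable (fun y : Metric.sphere (0 : E) 1 => φ k (r • (y : E)))
        (volume : Measure E).toSphere := fun k =>
      integrable_sphere_of_continuous ((hφ k).continuous.comp (continuous_subtype_val.const_smul r))
    rw [integral_sub (cint k) (cint l), hmean k r hr, hmean l r hr, sub_zero]
  have hab : ∀ k l, dist (b k) (b l) ≤ 2 / dim E * dist (a k) (a l) := by
    intro k l
    have hp := (hφ k).sub (hφ l)
    have h1 := hp.hardy_remainder (hmean' k l)
    have h2 : 0 ≤ ∫ x, dilGen (fun x => φ k x - φ l x) (fun x => g k x - g l x) x ^ 2 / ‖x‖ ^ 2 :=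
      integral_nonneg fun x => by simp only [Pi.zero_apply]; positivity
    have e1 : ‖a k - a l‖ ^ 2 = ∫ x, ‖g k x - g l x‖ ^ 2 := by
      rw [ha, ← MemLp.toLp_sub]
      exact norm_toLp_two_sq _
    have e2 : ‖b k - b l‖ ^ 2 = ∫ x, (φ k x - φ l x) ^ 2 / ‖x‖ ^ 2 := by
      rw [hb, ← MemLp.toLp_sub]
      refine (norm_toLp_two_sq _).trans (integral_congr_ae (ae_of_all _ fun x => ?_))
      simp only [Pi.sub_apply, ← sub_div, norm_div, div_pow, Real.norm_eq_abs, sq_abs]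
    rw [dist_eq_norm, dist_eq_norm]
    refine le_of_sq_le_sq ?_ (by positivity)
    rw [mul_pow, e1, e2, div_pow]
    have h3 : (dim E : ℝ) ^ 2 / 4 * (∫ x, (φ k x - φ l x) ^ 2 / ‖x‖ ^ 2) ≤
      ∫ x, ‖g k x - g l x‖ ^ 2 := by linarith
    rw [div_mul_eq_mul_div, le_div_iff₀ (by positivity)]
    linarith
  have hlimA : Tendsto a atTop (𝓝 (hG.toLp G)) :=
    (Lp.tendsto_Lp_iff_tendsto_eLpNorm'' _ (fun k => (hφ k).memLp_grad) G hG).2 hgG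
  have hcauchy : CauchySeq b := by
    rw [Metric.cauchySeq_iff]
    intro ε hε
    obtain ⟨n, hn⟩ := Metric.cauchySeq_iff.1 hlimA.cauchySeq (ε / (2 / dim E)) (by positivity)
    refine ⟨n, fun k hk l hl => (hab k l).trans_lt ?_⟩
    rw [mul_comm, ← lt_div_iff₀ (by positivity)]
    exact hn k hk l hl
  obtain ⟨B, hB⟩ := cauchySeq_tendsto_of_complete hcauchy
  have hBu : B =ᵐ[volume] fun x => u x / ‖x‖ := by
    obtain ⟨ns, hns, hns'⟩ := (tendstoInMeasure_of_tendsto_Lp hB).exists_seq_tendsto_ae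
    have hc : ∀ᵐ x, ∀ k, b k x = φ k x / ‖x‖ :=
      ae_all_iff.2 fun k => (hφ k).memLp_div_norm.coeFn_toLp
    filter_upwards [hns', hc, hu] with x h1 h2 h3
    simp only [h2] at h1
    exact tendsto_nhds_unique h1 ((h3.comp hns.tendsto_atTop).div_const _)
  have hmem : MemLp (fun x => u x / ‖x‖) 2 := (memLp_congr_ae hBu).1 (Lp.memLp B)
  have hint : Integrable fun x => u x ^ 2 / ‖x‖ ^ 2 := by
    simpa only [div_pow] using hmem.integrable_sq
  have hnB : ‖B‖ ^ 2 = ∫ x, u x ^ 2 / ‖x‖ ^ 2 := by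
    have : B = hmem.toLp := Lp.ext (hBu.trans hmem.coeFn_toLp.symm)
    rw [this]
    refine (norm_toLp_two_sq _).trans (integral_congr_ae (ae_of_all _ fun x => ?_))
    simp only [norm_div, div_pow, Real.norm_eq_abs, sq_abs]
  refine ⟨hint, ?_⟩
  rw [← norm_toLp_two_sq hG, ← hnB]
  set A := hG.toLp G
  -- the weighted estimate for `φ k` passes to the limit by Fatou's lemma
  set ρ : E → ℝ := fun x => ‖x‖ * Real.exp (-‖x‖) with hρ
  have hρ0 : ∀ x, 0 ≤ ρ x := fun x => by positivity
  have hρ1 : ∀ x, ρ x ≤ 1 := fun x => mul_exp_neg_le_one _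
  have hρm : Measurable ρ := by fun_prop
  have hintρ : ∀ v : E → ℝ, Integrable (fun x => v x ^ 2 / ‖x‖ ^ 2) →
      Integrable fun x => ρ x * (v x ^ 2 / ‖x‖ ^ 2) := fun v hv =>
    hv.bdd_mul (c := 1) hρm.aestronglyMeasurable
      (ae_of_all _ fun x => by rw [Real.norm_of_nonneg (hρ0 x)]; exact hρ1 x)
  have hnn : ∀ v : E → ℝ, ∀ x, 0 ≤ ρ x * (v x ^ 2 / ‖x‖ ^ 2) := fun v x =>
    mul_nonneg (hρ0 x) (by positivity)
  have hlim : ∀ ε : ℝ, 0 < ε → ∫ x, ρ x * (u x ^ 2 / ‖x‖ ^ 2) ≤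
      ε * ‖B‖ ^ 2 + ε⁻¹ * (‖A‖ ^ 2 - (dim E : ℝ) ^ 2 / 4 * ‖B‖ ^ 2) := by
    intro ε hε
    set c : ℕ → ℝ := fun k =>
      ε * ‖b k‖ ^ 2 + ε⁻¹ * (‖a k‖ ^ 2 - (dim E : ℝ) ^ 2 / 4 * ‖b k‖ ^ 2) with hc
    have hcl : Tendsto c atTop
        (𝓝 (ε * ‖B‖ ^ 2 + ε⁻¹ * (‖A‖ ^ 2 - (dim E : ℝ) ^ 2 / 4 * ‖B‖ ^ 2))) :=
      ((hB.norm.pow 2).const_mul _).add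
        (((hlimA.norm.pow 2).sub ((hB.norm.pow 2).const_mul _)).const_mul _)
    have hle : ∀ k, ∫ x, ρ x * (φ k x ^ 2 / ‖x‖ ^ 2) ≤ c k := fun k => by
      rw [hc]
      simp only
      rw [hna, hnb]
      exact (hφ k).integral_weighted_le_of_pos (hmean k) hε
    have hc0 : ∀ k, 0 ≤ c k := fun k => (integral_nonneg (hnn (φ k))).trans (hle k)
    rw [← ENNReal.ofReal_le_ofReal_iff (ge_of_tendsto' hcl hc0),
      ofReal_integral_eq_lintegral_ofReal (hintρ u hint) (ae_of_all _ (hnn u))]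
    calc ∫⁻ x, ENNReal.ofReal (ρ x * (u x ^ 2 / ‖x‖ ^ 2))
        = ∫⁻ x, liminf (fun k => ENNReal.ofReal (ρ x * (φ k x ^ 2 / ‖x‖ ^ 2))) atTop := by
          refine lintegral_congr_ae ?_
          filter_upwards [hu] with x hx
          exact (ENNReal.tendsto_ofReal (((hx.pow 2).div_const _).const_mul _)).liminf_eq.symm
      _ ≤ liminf (fun k => ∫⁻ x, ENNReal.ofReal (ρ x * (φ k x ^ 2 / ‖x‖ ^ 2))) atTop := by
          refine lintegral_liminf_le fun k => ?_
          have := (hφ k).measurable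
          fun_prop
      _ ≤ liminf (fun k => ENNReal.ofReal (c k)) atTop := by
          refine liminf_le_liminf (Eventually.of_forall fun k => ?_)
          rw [← ofReal_integral_eq_lintegral_ofReal (hintρ _ (hφ k).integrable_hardy)
            (ae_of_all _ (hnn (φ k)))]
          exact ENNReal.ofReal_le_ofReal (hle k)
      _ = _ := (ENNReal.tendsto_ofReal hcl).liminf_eq
  have hpos : 0 < ∫ x, ρ x * (u x ^ 2 / ‖x‖ ^ 2) := by
    refine lt_of_le_of_ne (integral_nonneg (hnn u)) fun h0 => hu0 ?_
    have h1 := (integral_eq_zero_iff_of_nonneg (hnn u) (hintρ u hint)).1 h0.symm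
    filter_upwards [h1, Measure.ae_ne volume (0 : E)] with x hx hx0
    have hn : ‖x‖ ≠ 0 := norm_ne_zero_iff.2 hx0
    simpa [hρ, hn, (Real.exp_pos _).ne'] using hx
  by_contra hcon
  have hcon' : ‖A‖ ^ 2 - (dim E : ℝ) ^ 2 / 4 * ‖B‖ ^ 2 ≤ 0 := by linarith [not_lt.1 hcon]
  set I := ∫ x, ρ x * (u x ^ 2 / ‖x‖ ^ 2)
  have hε : 0 < I / (2 * (‖B‖ ^ 2 + 1)) := by positivity
  have h1 := hlim _ hε
  have h2 := mul_nonpos_of_nonneg_of_nonpos (inv_nonneg.2 hε.le) hcon'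
  have h3 : I / (2 * (‖B‖ ^ 2 + 1)) * ‖B‖ ^ 2 ≤ I / 2 := by
    rw [div_mul_eq_mul_div, div_le_div_iff₀ (by positivity) (by positivity)]
    nlinarith [sq_nonneg ‖B‖]
  linarith

end completion

/-! ### Optimality of the constant -/

section optimal

/-- The power `r ^ (-c)`, cut off by `χ (r ^ p)`. -/
noncomputable def cutoffPower (χ : ℝ → ℝ) (c p r : ℝ) : ℝ := r ^ (-c) * χ (r ^ p)

/-- The derivative of `cutoffPower χ c p` on `(0, ∞)`. -/
noncomputable def cutoffPowerDeriv (χ : ℝ → ℝ) (c p r : ℝ) : ℝ :=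
  r ^ (-c) * (-c * χ (r ^ p) + p * (r ^ p * deriv χ (r ^ p))) / r

lemma hasDerivAt_cutoffPower {χ : ℝ → ℝ} (hχ : Differentiable ℝ χ) (c p : ℝ) {r : ℝ} (hr : 0 < r) :
    HasDerivAt (cutoffPower χ c p) (cutoffPowerDeriv χ c p r) r := by
  have h1 := Real.hasDerivAt_rpow_const (p := -c) (Or.inl hr.ne')
  have h2 := (hχ (r ^ p)).hasDerivAt.comp r (Real.hasDerivAt_rpow_const (p := p) (Or.inl hr.ne'))
  refine (h1.mul h2).congr_deriv ?_
  rw [Real.rpow_sub_one hr.ne', Real.rpow_sub_one hr.ne', cutoffPowerDeriv]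
  simp only [Function.comp_apply]
  ring

variable {E : Type*} [NormedAddCommGroup E] [InnerProductSpace ℝ E]

local notation "dim" => Module.finrank ℝ

lemma hasFDerivAt_norm_of_ne_zero {x : E} (hx : x ≠ 0) :
    HasFDerivAt (fun x : E => ‖x‖) (‖x‖⁻¹ • innerSL ℝ x) x := by
  have h := (hasStrictFDerivAt_norm_sq x).hasFDerivAt.sqrt (by positivity)
  simp only [Real.sqrt_sq (norm_nonneg _)] at h
  refine h.congr_fderiv ?_
  ext z
  simp
  field_simp

/-- The linear function `⟨e, ·⟩` times the radial profile `cutoffPower χ c p`: a spherical harmonic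
of degree one on each sphere. -/
noncomputable def firstHarmonic (χ : ℝ → ℝ) (c p : ℝ) (e x : E) : ℝ :=
  inner ℝ e x * cutoffPower χ c p ‖x‖

/-- The gradient of `firstHarmonic χ c p e`. -/
noncomputable def firstHarmonicGrad (χ : ℝ → ℝ) (c p : ℝ) (e x : E) : E :=
  cutoffPower χ c p ‖x‖ • e + (inner ℝ e x * (cutoffPowerDeriv χ c p ‖x‖ / ‖x‖)) • x

lemma rpow_neg_eq_sq {r : ℝ} (hr : 0 ≤ r) (d : ℝ) : r ^ (-d) = (r ^ (-(d / 2))) ^ 2 := by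
  rw [← Real.rpow_natCast, ← Real.rpow_mul hr]
  congr 1
  push_cast
  ring

/-- With the critical exponent `c = dim E / 2`, the sum over an orthonormal basis of the Dirichlet
densities is radial, and tends to `(dim E)²/4` times the Hardy density as `p → 0`. -/
lemma sum_norm_firstHarmonicGrad_sq (χ : ℝ → ℝ) (p : ℝ) {x : E} (hx : x ≠ 0) {ι : Type*} [Fintype ι]
    (b : OrthonormalBasis ι ℝ E) :
    ∑ i, ‖firstHarmonicGrad χ ((dim E : ℝ) / 2) p (b i) x‖ ^ 2 = ‖x‖ ^ (-(dim E : ℝ)) *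
      ((dim E : ℝ) ^ 2 / 4 * χ (‖x‖ ^ p) ^ 2 +
        (2 - dim E) * p * (χ (‖x‖ ^ p) * (‖x‖ ^ p * deriv χ (‖x‖ ^ p))) +
        p ^ 2 * (‖x‖ ^ p * deriv χ (‖x‖ ^ p)) ^ 2) := by
  have hn : ‖x‖ ≠ 0 := norm_ne_zero_iff.2 hx
  have hs : ∑ i, inner ℝ (b i) x ^ 2 = ‖x‖ ^ 2 := by
    simpa using b.sum_sq_norm_inner_right x
  have hpow := rpow_neg_eq_sq (norm_nonneg x) (dim E)
  have hi : ∀ i, ‖firstHarmonicGrad χ ((dim E : ℝ) / 2) p (b i) x‖ ^ 2 =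
      cutoffPower χ ((dim E : ℝ) / 2) p ‖x‖ ^ 2 + inner ℝ (b i) x ^ 2 *
        (2 * cutoffPower χ ((dim E : ℝ) / 2) p ‖x‖ *
            (cutoffPowerDeriv χ ((dim E : ℝ) / 2) p ‖x‖ / ‖x‖) +
          cutoffPowerDeriv χ ((dim E : ℝ) / 2) p ‖x‖ ^ 2) := by
    intro i
    rw [firstHarmonicGrad, norm_add_sq_real, norm_smul, norm_smul, inner_smul_left,
      inner_smul_right, b.norm_eq_one, mul_pow, mul_pow,
        Real.norm_eq_abs, Real.norm_eq_abs, sq_abs, sq_abs]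
    simp only [conj_trivial]
    field_simp
    ring
  simp_rw [hi]
  have hcard : (Fintype.card ι : ℝ) = dim E := by
    rw [Module.finrank_eq_card_basis b.toBasis]
  rw [Finset.sum_add_distrib, ← Finset.sum_mul, hs, Finset.sum_const, Finset.card_univ,
    nsmul_eq_mul, hcard, hpow, cutoffPower, cutoffPowerDeriv]
  field_simp
  ring

lemma sum_firstHarmonic_sq_div (χ : ℝ → ℝ) (p : ℝ) {x : E} (hx : x ≠ 0) {ι : Type*} [Fintype ι]
    (b : OrthonormalBasis ι ℝ E) :
    ∑ i, firstHarmonic χ ((dim E : ℝ) / 2) p (b i) x ^ 2 / ‖x‖ ^ 2 =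
      ‖x‖ ^ (-(dim E : ℝ)) * χ (‖x‖ ^ p) ^ 2 := by
  have hn : ‖x‖ ≠ 0 := norm_ne_zero_iff.2 hx
  have hs : ∑ i, inner ℝ (b i) x ^ 2 = ‖x‖ ^ 2 := by
    simpa using b.sum_sq_norm_inner_right x
  have hpow := rpow_neg_eq_sq (norm_nonneg x) (dim E)
  simp_rw [firstHarmonic, mul_pow]
  rw [← Finset.sum_div, ← Finset.sum_mul, hs, hpow, cutoffPower]
  field_simp

section
variable {χ : ℝ → ℝ} (hχ : ContDiff ℝ ∞ χ) (h1 : ∀ t ≤ 1, χ t = 0) (h3 : ∀ t, 3 ≤ t → χ t = 0)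
  (c : ℝ) {p : ℝ} (hp : 0 < p) (e : E)
include h1 hp

lemma firstHarmonic_eventually_eq_zero : firstHarmonic χ c p e =ᶠ[𝓝 0] fun _ => 0 := by
  filter_upwards [Metric.ball_mem_nhds (0 : E) one_pos] with x hx
  rw [mem_ball_zero_iff] at hx
  rw [firstHarmonic, cutoffPower, h1 _ (Real.rpow_le_one (norm_nonneg _) hx.le hp.le)]
  simp

include hχ

lemma contDiff_firstHarmonic : ContDiff ℝ ∞ (firstHarmonic χ c p e) := by
  rw [contDiff_iff_contDiffAt]
  intro x
  rcases eq_or_ne x 0 with rfl | hx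
  · exact contDiffAt_const.congr_of_eventuallyEq (firstHarmonic_eventually_eq_zero h1 c hp e)
  · have hn := contDiffAt_norm ℝ hx (n := ∞)
    have hn0 := norm_ne_zero_iff.2 hx
    exact ((innerSL ℝ e).contDiff.contDiffAt).mul ((hn.rpow_const_of_ne hn0).mul
      (hχ.contDiffAt.comp x (hn.rpow_const_of_ne hn0)))

variable [FiniteDimensional ℝ E]

lemma hasGradientAt_firstHarmonic (x : E) :
    HasGradientAt (firstHarmonic χ c p e) (firstHarmonicGrad χ c p e x) x := by
  rcases eq_or_ne x 0 with rfl | hx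
  · have : firstHarmonicGrad χ c p e (0 : E) = 0 := by
      simp [firstHarmonicGrad, cutoffPower, Real.zero_rpow hp.ne', h1 0 zero_le_one]
    rw [this]
    exact (hasGradientAt_const (0 : E) (0 : ℝ)).congr_of_eventuallyEq
      (firstHarmonic_eventually_eq_zero h1 c hp e)
  · have d1 := (hasDerivAt_cutoffPower (hχ.differentiable (by simp)) c p
      (norm_pos_iff.2 hx)).comp_hasFDerivAt x (hasFDerivAt_norm_of_ne_zero hx)
    have d2 := ((innerSL ℝ e).hasFDerivAt (x := x)).mul d1
    rw [hasGradientAt_iff_hasFDerivAt]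
    refine d2.congr_fderiv ?_
    ext z
    simp [firstHarmonicGrad]
    ring

include h3

lemma isTestPair_firstHarmonic :
    IsTestPair (firstHarmonic χ c p e) (firstHarmonicGrad χ c p e) where
  hasGradientAt := hasGradientAt_firstHarmonic hχ h1 c hp e
  continuous_grad := by
    have h := (contDiff_firstHarmonic hχ h1 c hp e).continuous_fderiv (by simp)
    have : firstHarmonicGrad χ c p e = fun x =>
        (InnerProductSpace.toDual ℝ E).symm (fderiv ℝ (firstHarmonic χ c p e) x) := by
      ext1 x
      exact (hasGradientAt_firstHarmonic hχ h1 c hp e x).gradient.symm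
    rw [this]
    exact (InnerProductSpace.toDual ℝ E).symm.continuous.comp h
  compactSupport := by
    refine HasCompactSupport.intro (isCompact_closedBall (0 : E) (3 ^ p⁻¹)) fun x hx => ?_
    have hx' : 3 ^ p⁻¹ ≤ ‖x‖ := by
      simpa using (not_le.1 (by simpa using hx) : (3:ℝ) ^ p⁻¹ < ‖x‖).le
    rw [firstHarmonic, cutoffPower,
      h3 _ ((Real.rpow_inv_le_iff_of_pos (by norm_num) (norm_nonneg _) hp).1 hx')]
    simp
  zero := by simp [firstHarmonic]

end

variable [FiniteDimensional ℝ E] [MeasurableSpace E] [BorelSpace E]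

open scoped Pointwise in
/-- The surface measure of the unit sphere is invariant under the antipodal map. -/
lemma measurePreserving_neg_sphere :
    MeasurePreserving (fun y : Metric.sphere (0 : E) 1 => -y) (volume : Measure E).toSphere
      (volume : Measure E).toSphere := by
  refine ⟨by fun_prop, ?_⟩
  ext s hs
  have hm : Measurable fun y : Metric.sphere (0 : E) 1 => -y := by fun_prop
  rw [Measure.map_apply hm hs, Measure.toSphere_apply' _ (hm hs), Measure.toSphere_apply' _ hs,
    ← Measure.measure_neg volume (Set.Ioo (0:ℝ) 1 • _)]
  congr 2
  ext x
  simp only [Set.mem_smul, Set.mem_image, Set.mem_preimage, Set.mem_neg]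
  constructor
  · rintro ⟨r, hr, _, ⟨y, hy, rfl⟩, hx⟩
    exact ⟨r, hr, _, ⟨-y, hy, rfl⟩, by simp [hx]⟩
  · rintro ⟨r, hr, _, ⟨y, hy, rfl⟩, hx⟩
    exact ⟨r, hr, _, ⟨-y, by simpa using hy, rfl⟩, by simp [hx]⟩

lemma integral_sphere_firstHarmonic (χ : ℝ → ℝ) (c p : ℝ) (e : E) (r : ℝ) :
    ∫ y : Metric.sphere (0 : E) 1, firstHarmonic χ c p e (r • (y : E))
      ∂(volume : Measure E).toSphere = 0 := by
  have h := (measurePreserving_neg_sphere (E := E)).integral_comp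
    (Homeomorph.neg _).measurableEmbedding
    (fun y : Metric.sphere (0 : E) 1 => firstHarmonic χ c p e (r • (y : E)))
  have h2 : ∀ y : Metric.sphere (0 : E) 1,
      firstHarmonic χ c p e (r • ((-y : Metric.sphere (0 : E) 1) : E))
      = -firstHarmonic χ c p e (r • (y : E)) := fun y => by simp [firstHarmonic]
  simp_rw [h2] at h
  rw [integral_neg] at h
  linarith

/-- In polar coordinates and with the substitution `y = r ^ p`, the parameter `p` only appears as a
factor `p⁻¹` in front of the integral. -/
lemma integral_norm_rpow_mul [Nontrivial E] {p : ℝ} (hp : 0 < p) (k : ℝ → ℝ) :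
    ∫ x : E, ‖x‖ ^ (-(dim E : ℝ)) * k (‖x‖ ^ p) =
      dim E * (volume : Measure E).real (Metric.ball 0 1) * p⁻¹ * ∫ y in Set.Ioi 0, k y / y := by
  rw [integral_fun_norm_addHaar volume (fun r => r ^ (-(dim E : ℝ)) * k (r ^ p)),
    ← integral_comp_rpow_Ioi_of_pos (g := fun y => k y / y) hp, nsmul_eq_mul, smul_eq_mul,
    mul_assoc, mul_assoc, ← integral_const_mul p⁻¹]
  congr 2
  refine setIntegral_congr_fun measurableSet_Ioi fun r (hr : 0 < r) => ?_
  obtain ⟨n, hn⟩ : ∃ n, dim E = n + 1 :=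
    Nat.exists_eq_succ_of_ne_zero (Module.finrank_pos (R := ℝ) (M := E)).ne'
  simp only [smul_eq_mul]
  rw [Real.rpow_neg hr.le, Real.rpow_natCast, hn, Nat.add_sub_cancel, Real.rpow_sub_one hr.ne']
  have := (Real.rpow_pos_of_pos hr p).ne'
  field_simp
  ring

/-- No constant above `(dim E)²/4` is admissible in the Hardy inequality, even for smooth functions
with vanishing spherical means. -/
theorem exists_testPair_lt [Nontrivial E] {C : ℝ} (hC : (dim E : ℝ) ^ 2 / 4 < C) :
    ∃ (u : E → ℝ) (g : E → E), IsTestPair u g ∧ ContDiff ℝ ∞ u ∧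
      (∀ r : ℝ, ∫ y : Metric.sphere (0 : E) 1, u (r • (y : E))
        ∂(volume : Measure E).toSphere = 0) ∧
      ∫ x, ‖g x‖ ^ 2 < C * ∫ x, u x ^ 2 / ‖x‖ ^ 2 := by
  have hd : (0:ℝ) < dim E := Nat.cast_pos.2 Module.finrank_pos
  let χb : ContDiffBump (2:ℝ) := ⟨1 / 2, 1, by norm_num, by norm_num⟩
  set χ : ℝ → ℝ := fun t => χb t with hχdef
  have hχ : ContDiff ℝ ∞ χ := χb.contDiff
  have h1 : ∀ t ≤ 1, χ t = 0 := fun t ht => χb.zero_of_le_dist (by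
    rw [Real.dist_eq, abs_sub_comm]
    exact (show (1:ℝ) ≤ 2 - t by linarith).trans (le_abs_self _))
  have h3 : ∀ t, 3 ≤ t → χ t = 0 := fun t ht => χb.zero_of_le_dist (by
    rw [Real.dist_eq]; exact (show (1:ℝ) ≤ t - 2 by linarith).trans (le_abs_self _))
  have h2 : χ 2 = 1 := χb.one_of_mem_closedBall (by simp [χb])
  have hd3 : ∀ t, 3 < t → deriv χ t = 0 := fun t ht => by
    have : χ =ᶠ[𝓝 t] fun _ => 0 := by
      filter_upwards [lt_mem_nhds ht] with s hs using h3 s hs.le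
    rw [this.deriv_eq, deriv_const]
  have hd1 : ∀ t, t < 1 → deriv χ t = 0 := fun t ht => by
    have : χ =ᶠ[𝓝 t] fun _ => 0 := by
      filter_upwards [gt_mem_nhds ht] with s hs using h1 s hs.le
    rw [this.deriv_eq, deriv_const]
  have hχc : Continuous χ := hχ.continuous
  have hχ'c : Continuous (deriv χ) := hχ.continuous_deriv (by simp)
  have hcs : ∀ k : ℝ → ℝ, Continuous k → (∀ t, 3 < ‖t‖ → k t = 0) → Integrable k := by
    intro k hk h0
    refine hk.integrable_of_hasCompactSupport
      (HasCompactSupport.intro (isCompact_closedBall (0:ℝ) 3) fun t ht => h0 t ?_)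
    simpa using ht
  have hsplit : ∀ t : ℝ, 3 < ‖t‖ → t < 1 ∨ 3 < t := by
    intro t ht
    rcases lt_abs.1 ht with h | h
    · exact Or.inr h
    · exact Or.inl (by linarith)
  have iχ2 : Integrable fun y => χ y ^ 2 := hcs _ (by fun_prop) fun t ht => by
    rcases hsplit t ht with h | h
    · rw [h1 t h.le]; simp
    · rw [h3 t h.le]; simp
  have iA : Integrable fun y => χ y ^ 2 / y := by
    refine iχ2.mono' (Measurable.aestronglyMeasurable
      ((hχc.measurable.pow_const 2).div measurable_id)) (ae_of_all _ fun y => ?_)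
    rcases le_total y 1 with hy | hy
    · simp [h1 y hy]
    · rw [Real.norm_of_nonneg (by positivity)]
      exact div_le_self (sq_nonneg _) hy
  have iB : Integrable fun y => χ y * deriv χ y := hcs _ (by fun_prop) fun t ht => by
    rcases hsplit t ht with h | h
    · rw [h1 t h.le]; simp
    · rw [h3 t h.le]; simp
  have iD : Integrable fun y => y * deriv χ y ^ 2 := hcs _ (by fun_prop) fun t ht => by
    rcases hsplit t ht with h | h
    · rw [hd1 t h]; simp
    · rw [hd3 t h]; simp
  set A := ∫ y in Set.Ioi (0:ℝ), χ y ^ 2 / y with hA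
  set B := ∫ y in Set.Ioi (0:ℝ), χ y * deriv χ y with hB
  set D := ∫ y in Set.Ioi (0:ℝ), y * deriv χ y ^ 2 with hD
  have hApos : 0 < A := by
    rw [hA, setIntegral_pos_iff_support_of_nonneg_ae _ iA.integrableOn]
    · refine lt_of_lt_of_le ((isOpen_ne_fun hχc continuous_const).inter isOpen_Ioi
        |>.measure_pos volume ⟨2, by simp [h2], ?_⟩) (measure_mono (?_ :
          {x | χ x ≠ 0} ∩ Set.Ioi 0 ⊆ _))
      · exact (two_pos : (0:ℝ) < 2)
      · intro y hy
        have hy0 : y ≠ 0 := ne_of_gt hy.2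
        have hy1 : χ y ≠ 0 := hy.1
        exact ⟨by simp [hy0, hy1], hy.2⟩
    · filter_upwards [ae_restrict_mem measurableSet_Ioi] with y (hy : 0 < y)
      simp only [Pi.zero_apply]
      positivity
  obtain ⟨p, hp, hlt⟩ : ∃ p : ℝ, 0 < p ∧
      (dim E : ℝ) ^ 2 / 4 * A + (2 - dim E) * p * B + p ^ 2 * D < C * A := by
    have hcont : Continuous fun p : ℝ =>
      (dim E : ℝ) ^ 2 / 4 * A + (2 - dim E) * p * B + p ^ 2 * D := by fun_prop
    have h := (hcont.tendsto 0).eventually_lt_const (u := C * A) (by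
      simpa using mul_lt_mul_of_pos_right hC hApos)
    obtain ⟨p, hp1, hp2⟩ := ((h.filter_mono nhdsWithin_le_nhds).and
      (self_mem_nhdsWithin (s := Set.Ioi (0:ℝ)))).exists
    exact ⟨p, hp2, hp1⟩
  set b := stdOrthonormalBasis ℝ E
  have hT : ∀ i, IsTestPair (firstHarmonic χ ((dim E : ℝ) / 2) p (b i))
      (firstHarmonicGrad χ ((dim E : ℝ) / 2) p (b i)) := fun i =>
    isTestPair_firstHarmonic hχ h1 h3 _ hp _
  have e1 : ∑ i, ∫ x, ‖firstHarmonicGrad χ ((dim E : ℝ) / 2) p (b i) x‖ ^ 2 =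
      dim E * (volume : Measure E).real (Metric.ball 0 1) * p⁻¹ *
        ((dim E : ℝ) ^ 2 / 4 * A + (2 - dim E) * p * B + p ^ 2 * D) := by
    rw [← integral_finsetSum _ fun i _ => (hT i).integrable_grad]
    set P : ℝ → ℝ := fun t => (dim E : ℝ) ^ 2 / 4 * χ t ^ 2 +
      (2 - dim E) * p * (χ t * (t * deriv χ t)) + p ^ 2 * (t * deriv χ t) ^ 2 with hP
    have : ∫ x, ∑ i, ‖firstHarmonicGrad χ ((dim E : ℝ) / 2) p (b i) x‖ ^ 2 =
        ∫ x : E, ‖x‖ ^ (-(dim E : ℝ)) * P (‖x‖ ^ p) := by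
      refine integral_congr_ae ?_
      filter_upwards [Measure.ae_ne volume (0 : E)] with x hx
      exact sum_norm_firstHarmonicGrad_sq χ p hx b
    have iAB : IntegrableOn (fun y => (dim E : ℝ) ^ 2 / 4 * (χ y ^ 2 / y) +
        (2 - dim E) * p * (χ y * deriv χ y)) (Set.Ioi 0) :=
      (iA.integrableOn.const_mul _).add (iB.integrableOn.const_mul _)
    rw [this, integral_norm_rpow_mul hp P]
    congr 1
    rw [hA, hB, hD, ← integral_const_mul, ← integral_const_mul, ← integral_const_mul,
      ← integral_add (iA.integrableOn.const_mul _) (iB.integrableOn.const_mul _),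
      ← integral_add iAB (iD.integrableOn.const_mul _)]
    refine setIntegral_congr_fun measurableSet_Ioi fun y (hy : 0 < y) => ?_
    simp only [hP]
    field_simp
  have e2 : ∑ i, ∫ x, firstHarmonic χ ((dim E : ℝ) / 2) p (b i) x ^ 2 / ‖x‖ ^ 2 =
      dim E * (volume : Measure E).real (Metric.ball 0 1) * p⁻¹ * A := by
    rw [← integral_finsetSum _ fun i _ => (hT i).integrable_hardy]
    have : ∫ x, ∑ i, firstHarmonic χ ((dim E : ℝ) / 2) p (b i) x ^ 2 / ‖x‖ ^ 2 =
        ∫ x : E, ‖x‖ ^ (-(dim E : ℝ)) * (fun t => χ t ^ 2) (‖x‖ ^ p) := by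
      refine integral_congr_ae ?_
      filter_upwards [Measure.ae_ne volume (0 : E)] with x hx
      exact sum_firstHarmonic_sq_div χ p hx b
    rw [this, integral_norm_rpow_mul hp fun t => χ t ^ 2]
  have hK : 0 < dim E * (volume : Measure E).real (Metric.ball 0 1) * p⁻¹ := by
    have : 0 < (volume : Measure E).real (Metric.ball 0 1) :=
      ENNReal.toReal_pos (Metric.measure_ball_pos _ _ one_pos).ne' measure_ball_lt_top.ne
    positivity
  -- the strict inequality holds for the sums over the basis, hence for one of the summands
  have hex : ∃ i, ∫ x, ‖firstHarmonicGrad χ ((dim E : ℝ) / 2) p (b i) x‖ ^ 2 <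
      C * ∫ x, firstHarmonic χ ((dim E : ℝ) / 2) p (b i) x ^ 2 / ‖x‖ ^ 2 := by
    by_contra! hcon
    have h := Finset.sum_le_sum fun i (_ : i ∈ Finset.univ) => hcon i
    rw [← Finset.mul_sum, e1, e2] at h
    have h' := mul_lt_mul_of_pos_left hlt hK
    linarith
  obtain ⟨i, hi⟩ := hex
  exact ⟨_, _, hT i, contDiff_firstHarmonic hχ h1 _ hp _, integral_sphere_firstHarmonic χ _ p _, hi⟩

end optimal

/-! ### Admissible functions -/

/-- The spherical average at radius zero is a positive multiple of the value at the origin. -/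
lemma HasSphericalAverageZero.apply_zero {N : ℕ} (hN : 1 ≤ N) {u : EuclideanSpace ℝ (Fin N) → ℝ}
    (hu : HasSphericalAverageZero u) : u 0 = 0 := by
  have : Nontrivial (EuclideanSpace ℝ (Fin N)) :=
    Module.nontrivial_of_finrank_pos (R := ℝ) (by rw [finrank_euclideanSpace_fin]; omega)
  have h := hu 0 le_rfl
  simp only [zero_smul, integral_const, smul_eq_mul, mul_eq_zero] at h
  refine h.resolve_left ?_
  rw [measureReal_def, ENNReal.toReal_eq_zero_iff]
  simp [Measure.measure_univ_eq_zero, Measure.toSphere_ne_zero, -Measure.toSphere_apply_univ]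

lemma IsAdmissible.isTestPair {N : ℕ} (hN : 1 ≤ N) {u : EuclideanSpace ℝ (Fin N) → ℝ}
    (hu : IsAdmissible u) : IsTestPair u (gradient u) where
  hasGradientAt x := (hu.smooth.differentiable (by simp) x).hasGradientAt
  continuous_grad := (InnerProductSpace.toDual ℝ _).symm.continuous.comp
    (hu.smooth.continuous_fderiv (by simp))
  compactSupport := hu.compactSupport
  zero := hu.averageZero.apply_zero hN

theorem mainTheorem8 (N : ℕ) (hN : 1 ≤ N) :
    -- the inequality
    (∀ u : EuclideanSpace ℝ (Fin N) → ℝ, IsAdmissible u →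
      Integrable (fun x => |u x| ^ 2 / ‖x‖ ^ 2) ∧
      Integrable (fun x => ‖gradient u x‖ ^ 2) ∧
      (N : ℝ) ^ 2 / 4 * (∫ x, |u x| ^ 2 / ‖x‖ ^ 2) ≤ (∫ x, ‖gradient u x‖ ^ 2)) ∧
    -- the constant is optimal
    (∀ C : ℝ, (N : ℝ) ^ 2 / 4 < C →
      ∃ u : EuclideanSpace ℝ (Fin N) → ℝ, IsAdmissible u ∧
        (∫ x, ‖gradient u x‖ ^ 2) < C * (∫ x, |u x| ^ 2 / ‖x‖ ^ 2)) ∧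
    -- it is not attained by a nonzero admissible function
    (∀ u : EuclideanSpace ℝ (Fin N) → ℝ, IsAdmissible u → u ≠ 0 →
      (N : ℝ) ^ 2 / 4 * (∫ x, |u x| ^ 2 / ‖x‖ ^ 2) < (∫ x, ‖gradient u x‖ ^ 2)) ∧
    -- nor by a nonzero element of the completion
    (∀ (u : EuclideanSpace ℝ (Fin N) → ℝ)
      (G : EuclideanSpace ℝ (Fin N) → EuclideanSpace ℝ (Fin N)),
      InEnergySpace u G → ¬ (u =ᵐ[volume] 0) →
        Integrable (fun x => |u x| ^ 2 / ‖x‖ ^ 2) ∧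
        (N : ℝ) ^ 2 / 4 * (∫ x, |u x| ^ 2 / ‖x‖ ^ 2) < (∫ x, ‖G x‖ ^ 2)) := by
  have hfin : Module.finrank ℝ (EuclideanSpace ℝ (Fin N)) = N := finrank_euclideanSpace_fin
  have : Nontrivial (EuclideanSpace ℝ (Fin N)) :=
    Module.nontrivial_of_finrank_pos (R := ℝ) (by omega)
  simp only [sq_abs]
  have completion : ∀ (u : EuclideanSpace ℝ (Fin N) → ℝ)
      (G : EuclideanSpace ℝ (Fin N) → EuclideanSpace ℝ (Fin N)),
      InEnergySpace u G → ¬ (u =ᵐ[volume] 0) →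
        Integrable (fun x => u x ^ 2 / ‖x‖ ^ 2) ∧
        (N : ℝ) ^ 2 / 4 * (∫ x, u x ^ 2 / ‖x‖ ^ 2) < (∫ x, ‖G x‖ ^ 2) := by
    rintro u G ⟨hG, φ, hφ, hae, hlim⟩ hu0
    have h := hardy_strict_of_tendsto (fun k => (hφ k).isTestPair hN)
      (fun k r hr => (hφ k).averageZero r hr.le) hG hae hlim hu0
    rwa [hfin] at h
  refine ⟨fun u hu => ?_, fun C hC => ?_, fun u hu hu0 => ?_, completion⟩
  · have hT := hu.isTestPair hN
    refine ⟨hT.integrable_hardy, hT.integrable_grad, ?_⟩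
    have h := hT.hardy_remainder fun r hr => hu.averageZero r hr.le
    rw [hfin] at h
    have h2 : 0 ≤ ∫ x, dilGen u (gradient u) x ^ 2 / ‖x‖ ^ 2 :=
      integral_nonneg fun x => by simp only [Pi.zero_apply]; positivity
    linarith
  · obtain ⟨u, g, hT, hsm, hmean, hlt⟩ := exists_testPair_lt
      (E := EuclideanSpace ℝ (Fin N)) (C := C) (by rwa [hfin])
    refine ⟨u, ⟨hsm, hT.compactSupport, fun r _ => hmean r⟩, ?_⟩
    have hg : gradient u = g := funext fun x => (hT.hasGradientAt x).gradient
    rwa [hg]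
  · have hT := hu.isTestPair hN
    refine (completion u (gradient u) ⟨hT.memLp_grad, fun _ => u, fun _ => hu,
      ae_of_all _ fun x => tendsto_const_nhds, by simp⟩ fun h0 => hu0 ?_).2
    exact (hT.continuous.ae_eq_iff_eq volume continuous_const).1 h0
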